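/- Work in homotopy type theory with a cumulative hierarchy of univalent universes $\mathcal U_0 : \mathcal U_1 : \cdots$, propositional truncations $\|X\|$, and nullifications. A collection of types in $\mathcal U_i$ is a function $T : I \to \mathcal U_i$. A presentation is a collection that contains the unit type $1$ and is closed under $\Sigma$ (if $X$ is merely in it and every $B(x)$, $x : X$, is merely in it, then so is $\sum_{x : X} B(x)$). The presentation $\langle T\rangle$ generated by $T$ is the collection of those $X : \mathcal U_i$ that satisfy the least mere predicate on $\mathcal U_i$ which holds for every $T(x)$, $x : I$, holds for $1$, and is closed under $\Sigma$ in this sense. For a type family $B : A \to \mathcal U_m$, a type $X$ is $B$-null if for all $a : A$ the diagonal map $X \to (B(a) \to X)$ is an equivalence; the nullification of $X$ at $B$ is a $B$-null type $\bigcirc_B X$ with a map $\eta_X : X \to \bigcirc_B X$ such that precomposition with $\eta_X$ is an equivalence $(\bigcirc_B X \to Y) \simeq (X \to Y)$ for every $B$-null type $Y$. The modality $\bigcirc_T$ generated by a collection $T$ is nullification at the family $x \mapsto \|T(x)\|$: its modal types are the null types of this family, with the above reflector and unit. Corollary. Let $i < m$ be universe levels. For every collection of types $T : I \to \mathcal U_i$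 with index type $I : \mathcal U_m$, the modalities $\bigcirc_T$ and $\bigcirc_{\langle T\rangle}$ on $\mathcal U_m$ are equal: they have the same modal types, the same reflector and the same unit. (This is a theorem of homotopy type theory: the type expressing it has a closed term.) -/

import Mathlib

/-!
Homotopy type theory, as a formal system: a lambda-calculus with dependent products, a cumulative
hierarchy of universes (à la Russell) and primitive constants, with untyped conversion, followed by
the notions of modality and presentation, which are expressions of that system.

Besides products and universes, the constants are: dependent sums, the unit type, identity types,
function extensionality, univalence, propositional truncation, nullification, and the
higher inductive predicate "belongs to the closure of a collection of types under unit and sums".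
No further type former is needed here; whatever is derivable stays derivable when more are added.
-/

namespace HoTT

/-! ### Raw syntax -/

/-- The primitive constants. Those that refer to a fixed universe `U i` carry the level `i`. -/
inductive Const : Type
  | sig | pair | sigInd
  | unit | star | unitInd
  | id | refl | idInd
  | funext | univalence (i : ℕ)
  | trunc | tr | truncEq | truncRec
  | gen (i : ℕ) | genOf (i : ℕ) | genUnit (i : ℕ) | genSig (i : ℕ) | genEq (i : ℕ)
  | genRec (i : ℕ)
  | null | eta | nullIsNull | nullRec
  deriving DecidableEq

/-- Raw terms, with de Bruijn indices. `pi A B` and `lam A t` bind one variable in `B` and `t`.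
Types are terms (universes are à la Russell). -/
inductive Tm : Type
  | var (n : ℕ)
  | univ (i : ℕ)
  | cst (c : Const)
  | pi (A B : Tm)
  | lam (A t : Tm)
  | app (f a : Tm)
  deriving DecidableEq

/-- Extend a renaming under a binder. -/
def liftRen (ρ : ℕ → ℕ) : ℕ → ℕ
  | 0 => 0
  | n + 1 => ρ n + 1

/-- Renaming of variables. -/
def Tm.ren : Tm → (ℕ → ℕ) → Tm
  | .var n, ρ => .var (ρ n)
  | .univ i, _ => .univ i
  | .cst c, _ => .cst c
  | .pi A B, ρ => .pi (A.ren ρ) (B.ren (liftRen ρ))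
  | .lam A t, ρ => .lam (A.ren ρ) (t.ren (liftRen ρ))
  | .app f a, ρ => .app (f.ren ρ) (a.ren ρ)

/-- Weakening by one variable. -/
def Tm.wk (t : Tm) : Tm := t.ren Nat.succ

/-- Extend a substitution under a binder. -/
def liftSub (σ : ℕ → Tm) : ℕ → Tm
  | 0 => .var 0
  | n + 1 => (σ n).wk

/-- Simultaneous substitution. -/
def Tm.sub : Tm → (ℕ → Tm) → Tm
  | .var n, σ => σ n
  | .univ i, _ => .univ i
  | .cst c, _ => .cst c
  | .pi A B, σ => .pi (A.sub σ) (B.sub (liftSub σ))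
  | .lam A t, σ => .lam (A.sub σ) (t.sub (liftSub σ))
  | .app f a, σ => .app (f.sub σ) (a.sub σ)

/-- The substitution of `a` for variable `0`. -/
def single (a : Tm) : ℕ → Tm
  | 0 => a
  | n + 1 => .var n

/-- `t.inst a` is `t[a/0]`. -/
def Tm.inst (t a : Tm) : Tm := t.sub (single a)

/-! ### Expressions with named binders

To write concrete terms with readable binders, an expression is given as a function of the number
`d` of variables in scope. The variable bound when `d` variables were in scope is, seen from a place
where `e` variables are in scope, the one of index `e - (d + 1)`. A closed expression `t` denotes
the raw term `t 0`. -/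

/-- Expressions: raw terms, as a function of the number of variables in scope. -/
abbrev Ex : Type := ℕ → Tm

def U (i : ℕ) : Ex := fun _ => .univ i

def con (c : Const) : Ex := fun _ => .cst c

def ap (f a : Ex) : Ex := fun d => .app (f d) (a d)

infixl:80 " ⬝ " => ap

/-- The dependent product `Π (x : A), B x`. -/
def pi (A : Ex) (B : Ex → Ex) : Ex :=
  fun d => .pi (A d) (B (fun e => .var (e - (d + 1))) (d + 1))

/-- The abstraction `λ (x : A), t x`. -/
def lam (A : Ex) (t : Ex → Ex) : Ex :=
  fun d => .lam (A d) (t (fun e => .var (e - (d + 1))) (d + 1))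

/-- The type of functions from `A` to `B`. -/
def arr (A B : Ex) : Ex := pi A fun _ => B

infixr:70 " ⇒ " => arr

/-- The dependent sum `Σ (x : A), B x`. -/
def sig (A : Ex) (B : Ex → Ex) : Ex := con .sig ⬝ A ⬝ lam A B

/-- The pair `(a, b) : Σ (x : A), B x`. -/
def mk (A : Ex) (B : Ex → Ex) (a b : Ex) : Ex := con .pair ⬝ A ⬝ lam A B ⬝ a ⬝ b

/-- The first projection of `p : Σ (x : A), B x`. -/
def fst (A : Ex) (B : Ex → Ex) (p : Ex) : Ex :=
  con .sigInd ⬝ A ⬝ lam A B ⬝ (lam (sig A B) fun _ => A) ⬝ (lam A fun a => lam (B a) fun _ => a) ⬝ p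

/-- The identity type `x = y` in `A`. -/
def eq (A x y : Ex) : Ex := con .id ⬝ A ⬝ x ⬝ y

def refl (A x : Ex) : Ex := con .refl ⬝ A ⬝ x

/-- The propositional truncation of `A`. -/
def trunc (A : Ex) : Ex := con .trunc ⬝ A

/-- The unit type. -/
def one : Ex := con .unit

/-- The dependent sum of a family `B : A ⇒ U` given as a function. -/
def sum (A B : Ex) : Ex := con .sig ⬝ A ⬝ B

/-- For a collection of types `T : I ⇒ U i` and a type `X : U i`, the proposition that `X` belongs
to the presentation generated by `T`, the closure of `T` under the unit type and dependent sums. -/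
def gen (i : ℕ) (I T X : Ex) : Ex := con (.gen i) ⬝ I ⬝ T ⬝ X

/-- The nullification of `X` at a family `B : A ⇒ U`. -/
def null (A B X : Ex) : Ex := con .null ⬝ A ⬝ B ⬝ X

/-- The map from `X` to its nullification. -/
def eta (A B X : Ex) : Ex := con .eta ⬝ A ⬝ B ⬝ X

/-! ### Basic notions -/

def isContr (A : Ex) : Ex := sig A fun a => pi A fun x => eq A a x

/-- `A` is a mere proposition. -/
def isProp (A : Ex) : Ex := pi A fun x => pi A fun y => eq A x y

/-- The homotopy fibre of `f : A ⇒ B` at `y : B`. -/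
def fib (A B f y : Ex) : Ex := sig A fun x => eq B (f ⬝ x) y

/-- `f : A ⇒ B` is an equivalence: its homotopy fibres are contractible. -/
def isEquiv (A B f : Ex) : Ex := pi B fun y => isContr (fib A B f y)

/-- The type of equivalences from `A` to `B`. -/
def equiv (A B : Ex) : Ex := sig (A ⇒ B) fun f => isEquiv A B f

/-- The identity function. -/
def idfun (A : Ex) : Ex := lam A fun x => x

/-- The identity function is an equivalence. -/
def idIsEquiv (A : Ex) : Ex :=
  lam A fun y =>
    let F := fun y' : Ex => fib A A (idfun A) y'
    let P := fun y' x : Ex => eq A (idfun A ⬝ x) y'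
    mk (F y) (fun w => pi (F y) fun w' => eq (F y) w w')
      (mk A (P y) y (refl A y))
      (con .sigInd ⬝ A ⬝ lam A (P y)
        ⬝ (lam (F y) fun w => eq (F y) (mk A (P y) y (refl A y)) w)
        ⬝ (lam A fun x => lam (P y x) fun p =>
            con .idInd ⬝ A
              ⬝ (lam A fun x' => lam A fun y' => lam (eq A x' y') fun p' =>
                  eq (F y') (mk A (P y') y' (refl A y')) (mk A (P y') x' p'))
              ⬝ (lam A fun x' => refl (F x') (mk A (P x') x' (refl A x')))
              ⬝ x ⬝ y ⬝ p))

/-- The function from identifications `A = B` in the universe `U i` to equivalences. -/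
def idToEquiv (i : ℕ) (A B : Ex) : Ex :=
  lam (eq (U i) A B) fun p =>
    con .idInd ⬝ U i
      ⬝ (lam (U i) fun X => lam (U i) fun Y => lam (eq (U i) X Y) fun _ => equiv X Y)
      ⬝ (lam (U i) fun X => mk (X ⇒ X) (fun f => isEquiv X X f) (idfun X) (idIsEquiv X))
      ⬝ A ⬝ B ⬝ p

/-- `X` is null for the family `B : A ⇒ U`: for all `a : A`, the diagonal map
`X ⇒ (B a ⇒ X)` is an equivalence. -/
def isNull (A B X : Ex) : Ex :=
  pi A fun a => isEquiv X (B ⬝ a ⇒ X) (lam X fun x => lam (B ⬝ a) fun _ => x)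

/-! ### The types of the constants

Each constant has the stated type for all levels `i` and `j`, except that a level carried by the
constant itself is fixed. -/

def constType (i j : ℕ) : Const → Ex
  -- dependent sums
  | .sig => pi (U i) fun A => (A ⇒ U i) ⇒ U i
  | .pair => pi (U i) fun A => pi (A ⇒ U i) fun B => pi A fun a => B ⬝ a ⇒ sum A B
  | .sigInd => pi (U i) fun A => pi (A ⇒ U i) fun B => pi (sum A B ⇒ U j) fun C =>
      (pi A fun a => pi (B ⬝ a) fun b => C ⬝ (con .pair ⬝ A ⬝ B ⬝ a ⬝ b)) ⇒
        pi (sum A B) fun p => C ⬝ p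
  -- the unit type
  | .unit => U i
  | .star => one
  | .unitInd => pi (one ⇒ U j) fun C => C ⬝ con .star ⇒ pi one fun x => C ⬝ x
  -- identity types
  | .id => pi (U i) fun A => A ⇒ A ⇒ U i
  | .refl => pi (U i) fun A => pi A fun x => eq A x x
  | .idInd => pi (U i) fun A => pi (pi A fun x => pi A fun y => eq A x y ⇒ U j) fun C =>
      (pi A fun x => C ⬝ x ⬝ x ⬝ refl A x) ⇒
        pi A fun x => pi A fun y => pi (eq A x y) fun p => C ⬝ x ⬝ y ⬝ p
  -- function extensionality and univalence
  | .funext => pi (U i) fun A => pi (A ⇒ U i) fun B =>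
      pi (pi A fun x => B ⬝ x) fun f => pi (pi A fun x => B ⬝ x) fun g =>
        (pi A fun x => eq (B ⬝ x) (f ⬝ x) (g ⬝ x)) ⇒ eq (pi A fun x => B ⬝ x) f g
  | .univalence i => pi (U i) fun A => pi (U i) fun B =>
      isEquiv (eq (U i) A B) (equiv A B) (idToEquiv i A B)
  -- propositional truncation
  | .trunc => U i ⇒ U i
  | .tr => pi (U i) fun A => A ⇒ trunc A
  | .truncEq => pi (U i) fun A => isProp (trunc A)
  | .truncRec => pi (U i) fun A => pi (U j) fun P => isProp P ⇒ (A ⇒ P) ⇒ trunc A ⇒ P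
  -- `gen i I T X`, for a collection of types `T : I ⇒ U i` and a type `X : U i`: the least mere
  -- predicate on `U i` that holds for all `T x` and for the unit type and is closed under sums
  | .gen i => pi (U (max (i + 1) j)) fun I => (I ⇒ U i) ⇒ U i ⇒ U (max (i + 1) j)
  | .genOf i => pi (U (max (i + 1) j)) fun I => pi (I ⇒ U i) fun T =>
      pi I fun x => gen i I T (T ⬝ x)
  | .genUnit i => pi (U (max (i + 1) j)) fun I => pi (I ⇒ U i) fun T => gen i I T one
  | .genSig i => pi (U (max (i + 1) j)) fun I => pi (I ⇒ U i) fun T =>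
      pi (U i) fun X => pi (X ⇒ U i) fun B => gen i I T X ⇒
        (pi X fun x => gen i I T (B ⬝ x)) ⇒ gen i I T (sum X B)
  | .genEq i => pi (U (max (i + 1) j)) fun I => pi (I ⇒ U i) fun T =>
      pi (U i) fun X => isProp (gen i I T X)
  | .genRec i => pi (U (max (i + 1) j)) fun I => pi (I ⇒ U i) fun T =>
      pi (U i ⇒ U j) fun C =>
        (pi (U i) fun X => isProp (C ⬝ X)) ⇒
        (pi I fun x => C ⬝ (T ⬝ x)) ⇒
        C ⬝ one ⇒
        (pi (U i) fun X => pi (X ⇒ U i) fun B =>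
          C ⬝ X ⇒ (pi X fun x => C ⬝ (B ⬝ x)) ⇒ C ⬝ (sum X B)) ⇒
        pi (U i) fun X => gen i I T X ⇒ C ⬝ X
  -- the nullification of `X` at a family `B : A ⇒ U i`, its unit, and its universal property
  | .null => pi (U i) fun A => (A ⇒ U i) ⇒ U i ⇒ U i
  | .eta => pi (U i) fun A => pi (A ⇒ U i) fun B => pi (U i) fun X =>
      X ⇒ null A B X
  | .nullIsNull => pi (U i) fun A => pi (A ⇒ U i) fun B => pi (U i) fun X =>
      isNull A B (null A B X)
  | .nullRec => pi (U i) fun A => pi (A ⇒ U i) fun B => pi (U i) fun X => pi (U j) fun Y =>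
      isNull A B Y ⇒
        isEquiv (null A B X ⇒ Y) (X ⇒ Y)
          (lam (null A B X ⇒ Y) fun g => lam X fun x => g ⬝ (eta A B X ⬝ x))

/-- The type of a constant at the levels `i` and `j`, as a closed raw term. -/
def constTy (c : Const) (i j : ℕ) : Tm := constType i j c 0

/-! ### Conversion and typing -/

/-- Application of a constant to a list of arguments. -/
def apps (c : Const) (l : List Tm) : Tm := l.foldl Tm.app (.cst c)

/-- Conversion: the congruence generated by the beta and eta rules for functions and the
computation rules of the eliminators. -/
inductive Conv : Tm → Tm → Prop
  | rfl (t : Tm) : Conv t t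
  | symm {t u : Tm} : Conv t u → Conv u t
  | trans {t u v : Tm} : Conv t u → Conv u v → Conv t v
  | pi {A A' B B' : Tm} : Conv A A' → Conv B B' → Conv (.pi A B) (.pi A' B')
  | lam {A A' t t' : Tm} : Conv A A' → Conv t t' → Conv (.lam A t) (.lam A' t')
  | app {f f' a a' : Tm} : Conv f f' → Conv a a' → Conv (.app f a) (.app f' a')
  | beta (A t a : Tm) : Conv (.app (.lam A t) a) (t.inst a)
  | eta (A f : Tm) : Conv (.lam A (.app f.wk (.var 0))) f
  | sigInd (A B C g A' B' a b : Tm) :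
      Conv (apps .sigInd [A, B, C, g, apps .pair [A', B', a, b]]) (.app (.app g a) b)
  | unitInd (C c : Tm) : Conv (apps .unitInd [C, c, .cst .star]) c
  | idInd (A C c x y A' z : Tm) :
      Conv (apps .idInd [A, C, c, x, y, apps .refl [A', z]]) (.app c z)
  | truncRec (A P h f A' a : Tm) :
      Conv (apps .truncRec [A, P, h, f, apps .tr [A', a]]) (.app f a)

/-- The typing judgement `Γ ⊢ t : A`. The head of the list `Γ` is the type of variable `0`. -/
inductive HasType : List Tm → Tm → Tm → Prop
  | univ (i : ℕ) : HasType [] (.univ i) (.univ (i + 1))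
  | cst (c : Const) (i j : ℕ) : HasType [] (.cst c) (constTy c i j)
  | var {Γ : List Tm} {A : Tm} {i : ℕ} : HasType Γ A (.univ i) → HasType (A :: Γ) (.var 0) A.wk
  | weaken {Γ : List Tm} {t A B : Tm} {i : ℕ} :
      HasType Γ t B → HasType Γ A (.univ i) → HasType (A :: Γ) t.wk B.wk
  | pi {Γ : List Tm} {A B : Tm} {i : ℕ} :
      HasType Γ A (.univ i) → HasType (A :: Γ) B (.univ i) → HasType Γ (.pi A B) (.univ i)
  | lam {Γ : List Tm} {A t B : Tm} {i : ℕ} :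
      HasType Γ (.pi A B) (.univ i) → HasType (A :: Γ) t B → HasType Γ (.lam A t) (.pi A B)
  | app {Γ : List Tm} {f a A B : Tm} :
      HasType Γ f (.pi A B) → HasType Γ a A → HasType Γ (.app f a) (B.inst a)
  | cumul {Γ : List Tm} {A : Tm} {i : ℕ} :
      HasType Γ A (.univ i) → HasType Γ A (.univ (i + 1))
  | conv {Γ : List Tm} {t A B : Tm} {i : ℕ} :
      HasType Γ t A → Conv A B → HasType Γ B (.univ i) → HasType Γ t B

/-- The closed expression `A` is a theorem of homotopy type theory: it denotes a closed type which
has a closed term. -/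
def Theorem (A : Ex) : Prop := ∃ t : Tm, HasType [] t (A 0)

/-! ### Modalities and presentations -/

/-- The type of the data of a modality on the universe `U m`: a subuniverse `M`, a reflector `O` and
a unit `X ⇒ O X`. The laws of a modality (`M X` is a mere proposition, `O X` is modal, modal
recursion, closure under sums) are mere propositions about these data, so two modalities are equal
if and only if their data are. -/
def modalityData (m : ℕ) : Ex :=
  sig (U m ⇒ U m) fun _M => sig (U m ⇒ U m) fun O => pi (U m) fun X => X ⇒ O ⬝ X

/-- The modality on `U m` given by nullification at `B : A ⇒ U m`: its modal types are the
`B`-null types, its reflector is nullification at `B`. -/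
def nullification (m : ℕ) (A B : Ex) : Ex :=
  mk (U m ⇒ U m) (fun _ => sig (U m ⇒ U m) fun O => pi (U m) fun X => X ⇒ O ⬝ X)
    (lam (U m) fun X => isNull A B X)
    (mk (U m ⇒ U m) (fun O => pi (U m) fun X => X ⇒ O ⬝ X)
      (lam (U m) fun X => null A B X)
      (lam (U m) fun X => eta A B X))

/-- The modality on `U m` generated by a collection of types `T` with index type `I : U m`:
nullification at the propositional truncations of the types of the collection. -/
def sheafification (m : ℕ) (I T : Ex) : Ex :=
  nullification m I (lam I fun x => trunc (T ⬝ x))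

/-- The index type of the presentation generated by `T : I ⇒ U i`: the types `X : U i` that belong
to the closure of `T` under unit and sums. -/
def generatedIndex (i : ℕ) (I T : Ex) : Ex := sig (U i) fun X => gen i I T X

/-- The presentation generated by `T : I ⇒ U i`, as a function on its index type. -/
def generated (i : ℕ) (I T : Ex) : Ex :=
  lam (generatedIndex i I T) fun p => fst (U i) (fun X => gen i I T X) p

end HoTT

namespace HoTT

/-! ### Substitution calculus -/

-- Mathematically, everything rests on the two families having the same null types. Since `T` is
-- contained in the presentation it generates, one inclusion is immediate. For the other, fix `X`
-- null for every `‖T x‖`. The predicate "`X` is null for `‖A‖`" is a mere proposition in `A`, so it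
-- suffices to see that it holds at `1`, where `‖1‖` is contractible, and is closed under sums
-- (`nulSum`). If `X` is null for `‖A‖` and for every `‖B a‖`, then, because `‖Σ A B‖` implies
-- `‖A‖`, nullness for `‖Σ A B‖` may be proved assuming `‖A‖` (`nulLocal`), hence assuming some `a :
-- A`; now `‖B a‖` implies `‖Σ A B‖`, and nullness passes to implied propositions (`nulMono`).
-- Least-ness of the generated predicate gives `nulGen`.
--
-- Two nullifications with the same null types have the same universal property, so for each `X`
-- they are equivalent as types under `X`, and univalence makes them equal there (`nullEq`).
-- Propositional extensionality identifies the predicates of being null, and function extensionality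
-- over `X` assembles predicate, reflector and unit into one path (`nullificationEq`).
--
-- Formally, a closed term must be exhibited and typed. The terms are written with level annotations
-- on their constants, and a type checker for annotated terms is proved sound and run in the kernel.
-- Levels are codes, sent to actual levels by a strictly increasing map, so a single run settles all
-- `i < m`. Each lemma is a variable in the context of the later ones; substituting the proofs for
-- these variables yields the closed term. Soundness needs no normalization or confluence, since
-- conversion is untyped and every reduct whose type matters is checked again.

theorem liftSub_var : liftSub Tm.var = Tm.var := by
  funext n; cases n <;> rfl

theorem Tm.sub_var (t : Tm) : t.sub Tm.var = t := by
  induction t <;> simp_all [Tm.sub, liftSub_var]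

theorem liftSub_comp_ren (ρ : ℕ → ℕ) :
    liftSub (fun n => Tm.var (ρ n)) = fun n => Tm.var (liftRen ρ n) := by
  funext n; cases n <;> rfl

theorem Tm.ren_eq_sub (t : Tm) (ρ : ℕ → ℕ) : t.ren ρ = t.sub fun n => .var (ρ n) := by
  induction t generalizing ρ <;> simp_all [Tm.sub, Tm.ren, liftSub_comp_ren]

theorem Tm.sub_ren (t : Tm) (ρ : ℕ → ℕ) (σ : ℕ → Tm) :
    (t.ren ρ).sub σ = t.sub fun n => σ (ρ n) := by
  have h (ρ : ℕ → ℕ) (σ : ℕ → Tm) :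
      (fun n => liftSub σ (liftRen ρ n)) = liftSub fun n => σ (ρ n) := by
    funext n; cases n <;> rfl
  induction t generalizing ρ σ <;> simp_all [Tm.sub, Tm.ren]

theorem Tm.ren_ren (t : Tm) (ρ ρ' : ℕ → ℕ) : (t.ren ρ).ren ρ' = t.ren fun n => ρ' (ρ n) := by
  rw [Tm.ren_eq_sub _ ρ', Tm.sub_ren, Tm.ren_eq_sub]

theorem Tm.ren_sub (t : Tm) (σ : ℕ → Tm) (ρ : ℕ → ℕ) :
    (t.sub σ).ren ρ = t.sub fun n => (σ n).ren ρ := by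
  have h (ρ : ℕ → ℕ) (σ : ℕ → Tm) :
      (fun n => (liftSub σ n).ren (liftRen ρ)) = liftSub fun n => (σ n).ren ρ := by
    funext n
    cases n with
    | zero => rfl
    | succ n => simp [liftSub, Tm.wk, Tm.ren_ren, liftRen]
  induction t generalizing ρ σ <;> simp_all [Tm.sub, Tm.ren]

theorem Tm.sub_sub (t : Tm) (σ τ : ℕ → Tm) : (t.sub σ).sub τ = t.sub fun n => (σ n).sub τ := by
  have h (σ τ : ℕ → Tm) :
      (fun n => (liftSub σ n).sub (liftSub τ)) = liftSub fun n => (σ n).sub τ := by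
    funext n
    cases n with
    | zero => rfl
    | succ n => simp [liftSub, Tm.wk, Tm.ren_sub, Tm.sub_ren]
  induction t generalizing σ τ <;> simp_all [Tm.sub]

theorem Tm.wk_sub (t : Tm) (σ : ℕ → Tm) : t.wk.sub σ = t.sub fun n => σ (n + 1) :=
  t.sub_ren _ _

theorem Tm.wk_sub_liftSub (t : Tm) (σ : ℕ → Tm) : t.wk.sub (liftSub σ) = (t.sub σ).wk := by
  rw [Tm.wk_sub, Tm.wk, Tm.ren_sub]; rfl

theorem Tm.inst_sub (t a : Tm) (σ : ℕ → Tm) :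
    (t.inst a).sub σ = (t.sub (liftSub σ)).inst (a.sub σ) := by
  rw [Tm.inst, Tm.inst, Tm.sub_sub, Tm.sub_sub]
  congr 1
  funext n
  cases n with
  | zero => rfl
  | succ n => simpa [single, liftSub, Tm.sub, Tm.wk, Tm.sub_ren] using (Tm.sub_var _).symm

theorem constTy_sub (c : Const) (i j : ℕ) (σ : ℕ → Tm) : (constTy c i j).sub σ = constTy c i j := by
  cases c <;> rfl

theorem Conv.sub {t u : Tm} (h : Conv t u) (σ : ℕ → Tm) : Conv (t.sub σ) (u.sub σ) := by
  induction h generalizing σ with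
  | rfl t => exact .rfl _
  | symm _ ih => exact (ih σ).symm
  | trans _ _ ih ih' => exact (ih σ).trans (ih' σ)
  | pi _ _ ih ih' => exact .pi (ih σ) (ih' _)
  | lam _ _ ih ih' => exact .lam (ih σ) (ih' _)
  | app _ _ ih ih' => exact .app (ih σ) (ih' σ)
  | beta A t a => rw [Tm.inst_sub]; exact .beta _ _ _
  | eta A f =>
    have := Conv.eta (A.sub σ) (f.sub σ)
    rwa [← Tm.wk_sub_liftSub] at this
  | sigInd => exact .sigInd ..
  | unitInd => exact .unitInd ..
  | idInd => exact .idInd ..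
  | truncRec => exact .truncRec ..

/-! ### A presentation of the typing judgement without structural rules -/

/-- `Lookup Γ n A`: the variable `n` has type `A` in the context `Γ`. -/
inductive Lookup : List Tm → ℕ → Tm → Prop
  | zero (A : Tm) (Γ : List Tm) : Lookup (A :: Γ) 0 A.wk
  | succ {Γ : List Tm} {n : ℕ} {A : Tm} (B : Tm) : Lookup Γ n A → Lookup (B :: Γ) (n + 1) A.wk

/-- Typing with a variable rule in place of weakening, and with the domain of an abstraction
required to be a type. -/
inductive Der : List Tm → Tm → Tm → Prop
  | univ (Γ : List Tm) (i : ℕ) : Der Γ (.univ i) (.univ (i + 1))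
  | cst (Γ : List Tm) (c : Const) (i j : ℕ) : Der Γ (.cst c) (constTy c i j)
  | var {Γ : List Tm} {n : ℕ} {A : Tm} : Lookup Γ n A → Der Γ (.var n) A
  | pi {Γ : List Tm} {A B : Tm} {i : ℕ} :
      Der Γ A (.univ i) → Der (A :: Γ) B (.univ i) → Der Γ (.pi A B) (.univ i)
  | lam {Γ : List Tm} {A t B : Tm} {i : ℕ} : Der Γ A (.univ i) → Der (A :: Γ) B (.univ i) →
      Der (A :: Γ) t B → Der Γ (.lam A t) (.pi A B)
  | app {Γ : List Tm} {f a A B : Tm} :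
      Der Γ f (.pi A B) → Der Γ a A → Der Γ (.app f a) (B.inst a)
  | cumul {Γ : List Tm} {A : Tm} {i : ℕ} : Der Γ A (.univ i) → Der Γ A (.univ (i + 1))
  | conv {Γ : List Tm} {t A B : Tm} {i : ℕ} :
      Der Γ t A → Conv A B → Der Γ B (.univ i) → Der Γ t B

theorem Der.cumul_le {Γ : List Tm} {A : Tm} {i j : ℕ} (h : Der Γ A (.univ i)) (hij : i ≤ j) :
    Der Γ A (.univ j) := by
  induction hij with
  | refl => exact h
  | step _ ih => exact ih.cumul

/-- Typed substitutions. -/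
def Realizes (Δ Γ : List Tm) (σ : ℕ → Tm) : Prop :=
  ∀ n A, Lookup Γ n A → Der Δ (σ n) (A.sub σ)

theorem Der.ren {Γ : List Tm} {t A : Tm} (h : Der Γ t A) {Δ : List Tm} {ρ : ℕ → ℕ}
    (hρ : ∀ n A, Lookup Γ n A → Lookup Δ (ρ n) (A.ren ρ)) : Der Δ (t.ren ρ) (A.ren ρ) := by
  have lift {Γ Δ : List Tm} {ρ : ℕ → ℕ} (A : Tm)
      (hρ : ∀ n A, Lookup Γ n A → Lookup Δ (ρ n) (A.ren ρ)) :
      ∀ n B, Lookup (A :: Γ) n B → Lookup (A.ren ρ :: Δ) (liftRen ρ n) (B.ren (liftRen ρ)) := by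
    intro n B hB
    have h (C : Tm) : C.wk.ren (liftRen ρ) = (C.ren ρ).wk := by
      simp [Tm.wk, Tm.ren_ren, liftRen]
    cases hB with
    | zero => rw [h]; exact .zero _ _
    | succ _ hB => rw [h]; exact .succ _ (hρ _ _ hB)
  induction h generalizing Δ ρ with
  | univ Γ i => exact .univ _ _
  | cst Γ c i j =>
    have := Der.cst Δ c i j
    rwa [← constTy_sub c i j (fun n => .var (ρ n)), ← Tm.ren_eq_sub] at this
  | var h => exact .var (hρ _ _ h)
  | pi _ _ ih ih' => exact .pi (ih hρ) (ih' (lift _ hρ))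
  | lam _ _ _ ih ih' ih'' => exact .lam (ih hρ) (ih' (lift _ hρ)) (ih'' (lift _ hρ))
  | app _ _ ih ih' =>
    have := Der.app (ih hρ) (ih' hρ)
    rw [Tm.ren_eq_sub (Tm.inst _ _) ρ, Tm.inst_sub, liftSub_comp_ren, ← Tm.ren_eq_sub,
      ← Tm.ren_eq_sub]
    exact this
  | cumul _ ih => exact (ih hρ).cumul
  | conv _ hc _ ih ih' =>
    refine .conv (ih hρ) ?_ (ih' hρ)
    rw [Tm.ren_eq_sub, Tm.ren_eq_sub]
    exact hc.sub _

theorem Der.wk {Γ : List Tm} {t A : Tm} (h : Der Γ t A) (B : Tm) : Der (B :: Γ) t.wk A.wk :=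
  h.ren fun _ _ hl => .succ _ hl

theorem Realizes.lift {Γ Δ : List Tm} {σ : ℕ → Tm} (hσ : Realizes Δ Γ σ) (A : Tm) :
    Realizes (A.sub σ :: Δ) (A :: Γ) (liftSub σ) := by
  intro n B hB
  cases hB with
  | zero => rw [Tm.wk_sub_liftSub]; exact .var (.zero _ _)
  | succ _ hB => rw [Tm.wk_sub_liftSub]; exact (hσ _ _ hB).wk _

theorem Der.sub {Γ : List Tm} {t A : Tm} (h : Der Γ t A) {Δ : List Tm} {σ : ℕ → Tm}
    (hσ : Realizes Δ Γ σ) : Der Δ (t.sub σ) (A.sub σ) := by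
  induction h generalizing Δ σ with
  | univ Γ i => exact .univ _ _
  | cst Γ c i j => rw [constTy_sub]; exact .cst _ _ _ _
  | var h => exact hσ _ _ h
  | pi _ _ ih ih' => exact .pi (ih hσ) (ih' (hσ.lift _))
  | lam _ _ _ ih ih' ih'' => exact .lam (ih hσ) (ih' (hσ.lift _)) (ih'' (hσ.lift _))
  | app _ _ ih ih' => rw [Tm.inst_sub]; exact .app (ih hσ) (ih' hσ)
  | cumul _ ih => exact (ih hσ).cumul
  | conv _ hc _ ih ih' => exact .conv (ih hσ) (hc.sub _) (ih' hσ)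

theorem realizes_var (Γ : List Tm) : Realizes Γ Γ Tm.var := fun _ _ h => by
  rw [Tm.sub_var]; exact .var h

/-- Extension of a typed substitution. -/
def consSub (a : Tm) (σ : ℕ → Tm) : ℕ → Tm
  | 0 => a
  | n + 1 => σ n

theorem Realizes.cons {Γ Δ : List Tm} {σ : ℕ → Tm} {a A : Tm} (hσ : Realizes Δ Γ σ)
    (ha : Der Δ a (A.sub σ)) : Realizes Δ (A :: Γ) (consSub a σ) := by
  intro n B hB
  cases hB with
  | zero => rw [Tm.wk_sub]; exact ha
  | succ _ hB => rw [Tm.wk_sub]; exact hσ _ _ hB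

theorem single_eq_consSub (a : Tm) : single a = consSub a Tm.var := by
  funext n; cases n <;> rfl

theorem Der.inst {Γ : List Tm} {A B t a : Tm} (h : Der (A :: Γ) t B) (ha : Der Γ a A) :
    Der Γ (t.inst a) (B.inst a) := by
  rw [Tm.inst, Tm.inst, single_eq_consSub]
  exact h.sub ((realizes_var Γ).cons (by rwa [Tm.sub_var]))

/-- The identity substitution is typed between the two contexts, because variable `0` can be given
the type `A` by conversion. This serves abstractions whose written domain is only convertible to the
expected one. -/
theorem Der.conv_ctx {Γ : List Tm} {A A' t B : Tm} {i : ℕ} (h : Der (A :: Γ) t B)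
    (hc : Conv A' A) (hA : Der Γ A (.univ i)) : Der (A' :: Γ) t B := by
  have key : Realizes (A' :: Γ) (A :: Γ) Tm.var := by
    intro n C hC
    rw [Tm.sub_var]
    cases hC with
    | zero =>
      refine .conv (.var (.zero _ _)) ?_ (hA.wk A')
      simp only [Tm.wk, Tm.ren_eq_sub]
      exact hc.sub _
    | succ _ hC => exact .var (.succ _ hC)
  simpa only [Tm.sub_var] using h.sub key

/-- Cumulativity and conversion change only the type, not the subject, so below them the derivation
ends with the product rule. -/
theorem Der.pi_inv {Γ : List Tm} {A B C : Tm} (h : Der Γ (.pi A B) C) :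
    ∃ i, Der Γ A (.univ i) ∧ Der (A :: Γ) B (.univ i) := by
  generalize ht : Tm.pi A B = t at h
  induction h with
  | univ | cst | var | lam | app => cases ht
  | pi h h' => cases ht; exact ⟨_, h, h'⟩
  | cumul _ ih => exact ih ht
  | conv _ _ _ ih => exact ih ht

-- Return from `Der` to `HasType`.

/-- Contexts all of whose entries are types. -/
inductive WfCtx : List Tm → Prop
  | nil : WfCtx []
  | cons {Γ : List Tm} {A : Tm} {i : ℕ} : WfCtx Γ → HasType Γ A (.univ i) → WfCtx (A :: Γ)

theorem WfCtx.weaken_closed {Γ : List Tm} (hΓ : WfCtx Γ) {t A : Tm} (h : HasType [] t A)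
    (ht : t.wk = t) (hA : A.wk = A) : HasType Γ t A := by
  induction hΓ with
  | nil => exact h
  | cons _ hB ih => simpa only [ht, hA] using ih.weaken hB

theorem WfCtx.lookup {Γ : List Tm} (hΓ : WfCtx Γ) {n : ℕ} {A : Tm} (h : Lookup Γ n A) :
    HasType Γ (.var n) A := by
  induction h with
  | zero => cases hΓ with | cons _ hA => exact .var hA
  | succ _ _ ih => cases hΓ with | cons hΓ hA => exact (ih hΓ).weaken hA

/-- The axioms of `Der` hold in any list `Γ`, whereas `HasType` builds its contexts entry by entry;
`WfCtx` supplies the difference. -/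
theorem Der.hasType {Γ : List Tm} {t A : Tm} (h : Der Γ t A) (hΓ : WfCtx Γ) : HasType Γ t A := by
  induction h with
  | univ Γ i => exact hΓ.weaken_closed (.univ i) rfl rfl
  | cst Γ c i j =>
    refine hΓ.weaken_closed (.cst c i j) rfl ?_
    rw [Tm.wk, Tm.ren_eq_sub, constTy_sub]
  | var h => exact hΓ.lookup h
  | pi _ _ ih ih' => exact .pi (ih hΓ) (ih' (hΓ.cons (ih hΓ)))
  | lam _ _ _ ih ih' ih'' =>
    have hA := ih hΓ
    exact .lam (.pi hA (ih' (hΓ.cons hA))) (ih'' (hΓ.cons hA))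
  | app _ _ ih ih' => exact .app (ih hΓ) (ih' hΓ)
  | cumul _ ih => exact (ih hΓ).cumul
  | conv _ hc _ ih ih' => exact .conv (ih hΓ) hc (ih' hΓ)

/-! ### Annotated terms

Terms in which every constant carries the levels at which it is used. The levels of an annotated
term are codes, to be interpreted by a strictly increasing function `φ : ℕ → ℕ`. -/

inductive Pre : Type
  | var (n : ℕ)
  | univ (i : ℕ)
  | cst (c : Const) (i j : ℕ)
  | pi (A B : Pre)
  | lam (A t : Pre)
  | app (f a : Pre)

/-- Reinterpretation of the level carried by a constant. -/
def Const.map (φ : ℕ → ℕ) : Const → Const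
  | .univalence i => .univalence (φ i)
  | .gen i => .gen (φ i)
  | .genOf i => .genOf (φ i)
  | .genUnit i => .genUnit (φ i)
  | .genSig i => .genSig (φ i)
  | .genEq i => .genEq (φ i)
  | .genRec i => .genRec (φ i)
  | c => c

namespace Pre

/-- The raw term denoted by an annotated term. -/
def toTm (φ : ℕ → ℕ) : Pre → Tm
  | var n => .var n
  | univ i => .univ (φ i)
  | cst c _ _ => .cst (c.map φ)
  | pi A B => .pi (A.toTm φ) (B.toTm φ)
  | lam A t => .lam (A.toTm φ) (t.toTm φ)
  | app f a => .app (f.toTm φ) (a.toTm φ)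

/-- Weakening by `d` variables, inserted above the variable `k`. -/
def lift (d : ℕ) : Pre → ℕ → Pre
  | var n, k => bif n.blt k then var n else var (n + d)
  | univ i, _ => univ i
  | cst c i j, _ => cst c i j
  | pi A B, k => pi (A.lift d k) (B.lift d (k + 1))
  | lam A t, k => lam (A.lift d k) (t.lift d (k + 1))
  | app f a, k => app (f.lift d k) (a.lift d k)

/-- Substitution of `a` for the variable `k`. -/
def inst (a : Pre) : Pre → ℕ → Pre
  | var n, k => bif n.blt k then var n else bif n.beq k then a.lift k 0 else var (n - 1)
  | univ i, _ => univ i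
  | cst c i j, _ => cst c i j
  | pi A B, k => pi (inst a A k) (inst a B (k + 1))
  | lam A t, k => lam (inst a A k) (inst a t (k + 1))
  | app f b, k => app (inst a f k) (inst a b k)

theorem liftRen_iterate (d k n : ℕ) :
    liftRen^[k] (fun n => n + d) n = bif n.blt k then n else n + d := by
  induction k generalizing n with
  | zero => rfl
  | succ k ih =>
    rw [Function.iterate_succ_apply']
    cases n with
    | zero => rfl
    | succ n =>
      rw [liftRen, ih]
      have : (n + 1).blt (k + 1) = n.blt k := rfl
      rw [this]
      cases n.blt k <;> simp; omega

theorem toTm_lift (φ : ℕ → ℕ) (d : ℕ) (t : Pre) (k : ℕ) :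
    (t.lift d k).toTm φ = (t.toTm φ).ren (liftRen^[k] fun n => n + d) := by
  induction t generalizing k with
  | var n =>
    rw [toTm, Tm.ren, liftRen_iterate, lift]
    cases n.blt k <;> rfl
  | univ | cst => rfl
  | pi A B ihA ihB => simp [lift, toTm, Tm.ren, ihA, ihB, Function.iterate_succ_apply']
  | lam A B ihA ihB => simp [lift, toTm, Tm.ren, ihA, ihB, Function.iterate_succ_apply']
  | app A B ihA ihB => simp [lift, toTm, Tm.ren, ihA, ihB]

theorem liftSub_iterate (a : Tm) (k n : ℕ) :
    liftSub^[k] (single a) n =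
      bif n.blt k then .var n else bif n.beq k then a.ren (fun n => n + k) else .var (n - 1) := by
  induction k generalizing n with
  | zero =>
    cases n with
    | zero =>
      change a = a.ren _
      simpa [Tm.ren_eq_sub] using a.sub_var.symm
    | succ n => rfl
  | succ k ih =>
    rw [Function.iterate_succ_apply']
    cases n with
    | zero => rfl
    | succ n =>
      rw [liftSub, ih]
      have h : (n + 1).blt (k + 1) = n.blt k := rfl
      have h' : (n + 1).beq (k + 1) = n.beq k := rfl
      rw [h, h']
      rcases hb : n.blt k with _ | _
      · rcases hb' : n.beq k with _ | _
        · have h1 : ¬ n < k := by rw [← Nat.blt_eq, hb]; simp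
          have h2 : n ≠ k := by rintro rfl; simp [Nat.beq_refl] at hb'
          simp only [cond_false, Tm.wk, Tm.ren]
          congr 1
          omega
        · simp only [cond_false, cond_true, Tm.wk, Tm.ren_ren]
          rfl
      · rfl

theorem toTm_inst (φ : ℕ → ℕ) (a t : Pre) (k : ℕ) :
    (inst a t k).toTm φ = (t.toTm φ).sub (liftSub^[k] (single (a.toTm φ))) := by
  induction t generalizing k with
  | var n =>
    rw [toTm, Tm.sub, liftSub_iterate, inst]
    cases n.blt k
    · cases n.beq k
      · rfl
      · simp [toTm_lift]
    · rfl
  | univ | cst => rfl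
  | pi A B ihA ihB => simp [inst, toTm, Tm.sub, ihA, ihB, Function.iterate_succ_apply']
  | lam A B ihA ihB => simp [inst, toTm, Tm.sub, ihA, ihB, Function.iterate_succ_apply']
  | app A B ihA ihB => simp [inst, toTm, Tm.sub, ihA, ihB]

/-! ### Reduction and conversion of annotated terms -/

/-- The head of an iterated application, and its arguments followed by `l`. -/
def spine : Pre → List Pre → Pre × List Pre
  | app f a, l => spine f (a :: l)
  | t, l => (t, l)

/-- Iterated application. -/
def mkApps (t : Pre) : List Pre → Pre
  | [] => t
  | a :: l => mkApps (app t a) l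

theorem mkApps_spine (t : Pre) (l : List Pre) :
    mkApps (t.spine l).1 (t.spine l).2 = mkApps t l := by
  induction t generalizing l with
  | app f a ih _ => exact ih _
  | _ => rfl

/-- Reduction of an eliminator applied to a constructor, where `w` reduces the scrutinee. -/
def iota (w : Pre → Pre) (t : Pre) : Option Pre :=
  match t.spine [] with
  | (cst .sigInd _ _, [_, _, _, g, p]) =>
    match (w p).spine [] with
    | (cst .pair _ _, [_, _, a, b]) => some (app (app g a) b)
    | _ => none
  | (cst .unitInd _ _, [_, c, x]) =>
    match w x with
    | cst .star _ _ => some c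
    | _ => none
  | (cst .idInd _ _, [_, _, c, _, _, p]) =>
    match (w p).spine [] with
    | (cst .refl _ _, [_, z]) => some (app c z)
    | _ => none
  | (cst .truncRec _ _, [_, _, _, f, x]) =>
    match (w x).spine [] with
    | (cst .tr _ _, [_, a]) => some (app f a)
    | _ => none
  | _ => none

/-- Weak head reduction, with a bound on the number of steps. -/
def whnf : ℕ → Pre → Pre
  | n + 1, app f a =>
    match whnf n f with
    | lam _ b => whnf n (inst a b 0)
    | f' =>
      match iota (whnf n) (app f' a) with
      | some t => whnf n t
      | none => app f' a
  | _, t => t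

theorem eq_of_spine {t h : Pre} {l : List Pre} (e : t.spine [] = (h, l)) : t = mkApps h l := by
  have := mkApps_spine t []
  rw [e] at this
  exact this.symm

/-- The computation rules of `Conv` do not ask the parameters of the constructor to agree with those
of the eliminator, so matching the shape of the two spines is enough. -/
theorem conv_iota (φ : ℕ → ℕ) {w : Pre → Pre} (hw : ∀ t, Conv (t.toTm φ) ((w t).toTm φ))
    {t u : Pre} (h : iota w t = some u) : Conv (t.toTm φ) (u.toTm φ) := by
  unfold iota at h
  split at h
  · rename_i p e
    split at h
    · rename_i e'
      cases h
      rw [eq_of_spine e]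
      have := hw p
      rw [eq_of_spine e'] at this
      exact .trans (.app (.rfl _) this) (.sigInd ..)
    · cases h
  · rename_i x e
    split at h
    · rename_i e'
      cases h
      rw [eq_of_spine e]
      have := hw x
      rw [e'] at this
      exact .trans (.app (.rfl _) this) (.unitInd ..)
    · cases h
  · rename_i p e
    split at h
    · rename_i e'
      cases h
      rw [eq_of_spine e]
      have := hw p
      rw [eq_of_spine e'] at this
      exact .trans (.app (.rfl _) this) (.idInd ..)
    · cases h
  · rename_i x e
    split at h
    · rename_i e'
      cases h
      rw [eq_of_spine e]
      have := hw x
      rw [eq_of_spine e'] at this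
      exact .trans (.app (.rfl _) this) (.truncRec ..)
    · cases h
  · cases h

theorem toTm_inst_zero (φ : ℕ → ℕ) (a t : Pre) :
    (inst a t 0).toTm φ = (t.toTm φ).inst (a.toTm φ) := toTm_inst φ a t 0

theorem conv_whnf (φ : ℕ → ℕ) (n : ℕ) (t : Pre) : Conv (t.toTm φ) ((whnf n t).toTm φ) := by
  induction n generalizing t with
  | zero => cases t <;> exact .rfl _
  | succ n ih =>
    cases t with
    | app f a =>
      have hf := ih f
      rw [whnf]
      split
      · rename_i b e
        rw [e] at hf
        refine .trans (.app hf (.rfl _)) (.trans (.beta _ _ _) ?_)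
        rw [← toTm_inst_zero]
        exact ih _
      · refine .trans (.app hf (.rfl _)) ?_
        split
        · rename_i e
          exact .trans (conv_iota φ ih e) (ih _)
        · exact .rfl _
    | _ => exact .rfl _

/-- A number for each constant, and the level that it carries. -/
def _root_.HoTT.Const.code : Const → ℕ × ℕ
  | .unit => (0, 0) | .star => (1, 0) | .unitInd => (2, 0)
  | .sig => (3, 0) | .pair => (4, 0) | .sigInd => (5, 0)
  | .id => (6, 0) | .refl => (7, 0) | .idInd => (8, 0)
  | .funext => (9, 0)
  | .trunc => (10, 0) | .tr => (11, 0) | .truncEq => (12, 0) | .truncRec => (13, 0)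
  | .null => (14, 0) | .eta => (15, 0) | .nullIsNull => (16, 0) | .nullRec => (17, 0)
  | .univalence i => (18, i)
  | .gen i => (19, i) | .genOf i => (20, i) | .genUnit i => (21, i) | .genSig i => (22, i)
  | .genEq i => (23, i) | .genRec i => (24, i)

/-- Equality of annotated terms, up to annotations. -/
def same : Pre → Pre → Bool
  | var n, var n' => n.beq n'
  | univ i, univ i' => i.beq i'
  | cst c _ _, cst c' _ _ => c.code.1.beq c'.code.1 && c.code.2.beq c'.code.2
  | pi A B, pi A' B' => same A A' && same B B'
  | lam A t, lam A' t' => same A A' && same t t'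
  | app f a, app f' a' => same f f' && same a a'
  | _, _ => false

theorem code_injective {c c' : Const} (h : c.code = c'.code) : c = c' := by
  cases c <;> cases c' <;> simp_all [Const.code]

theorem toTm_eq_of_same (φ : ℕ → ℕ) {t u : Pre} (h : same t u = true) :
    t.toTm φ = u.toTm φ := by
  induction t generalizing u with
  | cst c =>
    cases u <;> simp [same] at h
    rw [toTm, toTm, code_injective (Prod.ext h.1 h.2)]
  | _ => cases u <;> simp_all [same, toTm] <;> grind

/-- Conversion of annotated terms. -/
def conv : ℕ → Pre → Pre → Bool
  | 0, _, _ => false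
  | n + 1, t, u =>
    same t u ||
      match whnf n t, whnf n u with
      | pi A B, pi A' B' => conv n A A' && conv n B B'
      | lam A t, lam A' t' => conv n A A' && conv n t t'
      | lam _ t, u => conv n t (app (u.lift 1 0) (var 0))
      | t, lam _ u => conv n (app (t.lift 1 0) (var 0)) u
      | app f a, app f' a' => conv n f f' && conv n a a'
      | t, u => same t u

theorem toTm_lift_one (φ : ℕ → ℕ) (t : Pre) : (t.lift 1 0).toTm φ = (t.toTm φ).wk :=
  toTm_lift φ 1 t 0

theorem conv_sound (φ : ℕ → ℕ) {n : ℕ} {t u : Pre} (h : conv n t u = true) :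
    Conv (t.toTm φ) (u.toTm φ) := by
  induction n generalizing t u with
  | zero => cases h
  | succ n ih =>
    rw [conv, Bool.or_eq_true] at h
    rcases h with h | h
    · rw [toTm_eq_of_same φ h]; exact .rfl _
    refine .trans (conv_whnf φ n t) (.trans ?_ (conv_whnf φ n u).symm)
    split at h
    · rename_i e e'
      rw [Bool.and_eq_true] at h
      rw [e, e']
      exact .pi (ih h.1) (ih h.2)
    · rename_i e e'
      rw [Bool.and_eq_true] at h
      rw [e, e']
      exact .lam (ih h.1) (ih h.2)
    · rename_i e _
      rw [e]
      refine .trans (.lam (.rfl _) (ih h)) ?_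
      rw [toTm, toTm_lift_one]
      exact .eta _ _
    · rename_i e _
      rw [e]
      refine .trans (.symm ?_) (.lam (.rfl _) (ih h))
      rw [toTm, toTm_lift_one]
      exact .eta _ _
    · rename_i e e'
      rw [Bool.and_eq_true] at h
      rw [e, e']
      exact .app (ih h.1) (ih h.2)
    · rw [toTm_eq_of_same φ h]; exact .rfl _

end Pre

/-! ### Annotated expressions with named binders -/

namespace Ann

open Pre

/-- Annotated expressions: annotated terms, as a function of the number of variables in scope. -/
abbrev Exp : Type := ℕ → Pre

/-- The variable bound when `d` variables were in scope. -/
def bound (d : ℕ) : Exp := fun e => .var (e - (d + 1))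

def U (i : ℕ) : Exp := fun _ => .univ i

def con (c : Const) (i j : ℕ) : Exp := fun _ => .cst c i j

def ap (f a : Exp) : Exp := fun d => .app (f d) (a d)

infixl:80 " ⋄ " => ap

def pi (A : Exp) (B : Exp → Exp) : Exp := fun d => .pi (A d) (B (bound d) (d + 1))

def lam (A : Exp) (t : Exp → Exp) : Exp := fun d => .lam (A d) (t (bound d) (d + 1))

def arr (A B : Exp) : Exp := pi A fun _ => B

infixr:70 " ⇾ " => arr

def sig (i : ℕ) (A : Exp) (B : Exp → Exp) : Exp := con .sig i i ⋄ A ⋄ lam A B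

def mk (i : ℕ) (A : Exp) (B : Exp → Exp) (a b : Exp) : Exp := con .pair i i ⋄ A ⋄ lam A B ⋄ a ⋄ b

/-- The dependent function on `Σ (x : A), B x` given by its values on pairs. -/
def uncurry (i j : ℕ) (A : Exp) (B C : Exp → Exp) (g : Exp → Exp → Exp) : Exp :=
  con .sigInd i j ⋄ A ⋄ lam A B ⋄ lam (sig i A B) C ⋄ (lam A fun a => lam (B a) fun b => g a b)

/-- Elimination of `p : Σ (x : A), B x` into `C p`. -/
def split (i j : ℕ) (A : Exp) (B C : Exp → Exp) (g : Exp → Exp → Exp) (p : Exp) : Exp :=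
  uncurry i j A B C g ⋄ p

def fst (i : ℕ) (A : Exp) (B : Exp → Exp) (p : Exp) : Exp :=
  split i i A B (fun _ => A) (fun a _ => a) p

def snd (i : ℕ) (A : Exp) (B : Exp → Exp) (p : Exp) : Exp :=
  split i i A B (fun q => B (fst i A B q)) (fun _ b => b) p

def eq (i : ℕ) (A x y : Exp) : Exp := con .id i i ⋄ A ⋄ x ⋄ y

def refl (i : ℕ) (A x : Exp) : Exp := con .refl i i ⋄ A ⋄ x

/-- Path induction. -/
def pathInd (i j : ℕ) (A : Exp) (C : Exp → Exp → Exp → Exp) (c : Exp → Exp) (x y p : Exp) : Exp :=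
  con .idInd i j ⋄ A ⋄ (lam A fun x => lam A fun y => lam (eq i A x y) fun p => C x y p) ⋄
    lam A c ⋄ x ⋄ y ⋄ p

def trunc (i : ℕ) (A : Exp) : Exp := con .trunc i i ⋄ A

def one (i : ℕ) : Exp := con .unit i i

def sum (i : ℕ) (A B : Exp) : Exp := con .sig i i ⋄ A ⋄ B

def gen (i j : ℕ) (I T X : Exp) : Exp := con (.gen i) j j ⋄ I ⋄ T ⋄ X

def null (i : ℕ) (A B X : Exp) : Exp := con .null i i ⋄ A ⋄ B ⋄ X

def eta (i : ℕ) (A B X : Exp) : Exp := con .eta i i ⋄ A ⋄ B ⋄ X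

def isContr (i : ℕ) (A : Exp) : Exp := sig i A fun a => pi A fun x => eq i A a x

def isProp (i : ℕ) (A : Exp) : Exp := pi A fun x => pi A fun y => eq i A x y

def fib (i : ℕ) (A B f y : Exp) : Exp := sig i A fun x => eq i B (f ⋄ x) y

def isEquiv (i : ℕ) (A B f : Exp) : Exp := pi B fun y => isContr i (fib i A B f y)

def equiv (i : ℕ) (A B : Exp) : Exp := sig i (A ⇾ B) fun f => isEquiv i A B f

def idfun (A : Exp) : Exp := lam A fun x => x

def idIsEquiv (i : ℕ) (A : Exp) : Exp :=
  lam A fun y =>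
    let F := fun y' : Exp => fib i A A (idfun A) y'
    let P := fun y' x : Exp => eq i A (idfun A ⋄ x) y'
    mk i (F y) (fun w => pi (F y) fun w' => eq i (F y) w w')
      (mk i A (P y) y (refl i A y))
      (uncurry i i A (P y) (fun w => eq i (F y) (mk i A (P y) y (refl i A y)) w)
        (fun x p => pathInd i i A
          (fun x' y' p' => eq i (F y') (mk i A (P y') y' (refl i A y')) (mk i A (P y') x' p'))
          (fun x' => refl i (F x') (mk i A (P x') x' (refl i A x')))
          x y p))

def idToEquiv (i : ℕ) (A B : Exp) : Exp :=
  lam (eq (i + 1) (U i) A B) fun p =>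
    pathInd (i + 1) i (U i) (fun X Y _ => equiv i X Y)
      (fun X => mk i (X ⇾ X) (fun f => isEquiv i X X f) (idfun X) (idIsEquiv i X)) A B p

def isNull (i : ℕ) (A B X : Exp) : Exp :=
  pi A fun a => isEquiv i X (B ⋄ a ⇾ X) (lam X fun x => lam (B ⋄ a) fun _ => x)

/-- The type of a constant at the levels `i` and `j`. A constant that carries a level `i` has the
type given here provided that `i < j`. -/
def constType (i j : ℕ) : Const → Exp
  | .sig => pi (U i) fun A => (A ⇾ U i) ⇾ U i
  | .pair => pi (U i) fun A => pi (A ⇾ U i) fun B => pi A fun a => B ⋄ a ⇾ sum i A B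
  | .sigInd => pi (U i) fun A => pi (A ⇾ U i) fun B => pi (sum i A B ⇾ U j) fun C =>
      (pi A fun a => pi (B ⋄ a) fun b => C ⋄ (con .pair i i ⋄ A ⋄ B ⋄ a ⋄ b)) ⇾
        pi (sum i A B) fun p => C ⋄ p
  | .unit => U i
  | .star => one i
  | .unitInd => pi (one i ⇾ U j) fun C => C ⋄ con .star i i ⇾ pi (one i) fun x => C ⋄ x
  | .id => pi (U i) fun A => A ⇾ A ⇾ U i
  | .refl => pi (U i) fun A => pi A fun x => eq i A x x
  | .idInd => pi (U i) fun A => pi (pi A fun x => pi A fun y => eq i A x y ⇾ U j) fun C =>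
      (pi A fun x => C ⋄ x ⋄ x ⋄ refl i A x) ⇾
        pi A fun x => pi A fun y => pi (eq i A x y) fun p => C ⋄ x ⋄ y ⋄ p
  | .funext => pi (U i) fun A => pi (A ⇾ U i) fun B =>
      pi (pi A fun x => B ⋄ x) fun f => pi (pi A fun x => B ⋄ x) fun g =>
        (pi A fun x => eq i (B ⋄ x) (f ⋄ x) (g ⋄ x)) ⇾ eq i (pi A fun x => B ⋄ x) f g
  | .univalence i => pi (U i) fun A => pi (U i) fun B =>
      isEquiv (i + 1) (eq (i + 1) (U i) A B) (equiv i A B) (idToEquiv i A B)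
  | .trunc => U i ⇾ U i
  | .tr => pi (U i) fun A => A ⇾ trunc i A
  | .truncEq => pi (U i) fun A => isProp i (trunc i A)
  | .truncRec => pi (U i) fun A => pi (U j) fun P => isProp j P ⇾ (A ⇾ P) ⇾ trunc i A ⇾ P
  | .gen i => pi (U j) fun I => (I ⇾ U i) ⇾ U i ⇾ U j
  | .genOf i => pi (U j) fun I => pi (I ⇾ U i) fun T => pi I fun x => gen i j I T (T ⋄ x)
  | .genUnit i => pi (U j) fun I => pi (I ⇾ U i) fun T => gen i j I T (one i)
  | .genSig i => pi (U j) fun I => pi (I ⇾ U i) fun T =>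
      pi (U i) fun X => pi (X ⇾ U i) fun B => gen i j I T X ⇾
        (pi X fun x => gen i j I T (B ⋄ x)) ⇾ gen i j I T (sum i X B)
  | .genEq i => pi (U j) fun I => pi (I ⇾ U i) fun T =>
      pi (U i) fun X => isProp j (gen i j I T X)
  | .genRec i => pi (U j) fun I => pi (I ⇾ U i) fun T =>
      pi (U i ⇾ U j) fun C =>
        (pi (U i) fun X => isProp j (C ⋄ X)) ⇾
        (pi I fun x => C ⋄ (T ⋄ x)) ⇾
        C ⋄ one i ⇾
        (pi (U i) fun X => pi (X ⇾ U i) fun B =>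
          C ⋄ X ⇾ (pi X fun x => C ⋄ (B ⋄ x)) ⇾ C ⋄ (sum i X B)) ⇾
        pi (U i) fun X => gen i j I T X ⇾ C ⋄ X
  | .null => pi (U i) fun A => (A ⇾ U i) ⇾ U i ⇾ U i
  | .eta => pi (U i) fun A => pi (A ⇾ U i) fun B => pi (U i) fun X => X ⇾ null i A B X
  | .nullIsNull => pi (U i) fun A => pi (A ⇾ U i) fun B => pi (U i) fun X =>
      isNull i A B (null i A B X)
  | .nullRec => pi (U i) fun A => pi (A ⇾ U i) fun B => pi (U i) fun X => pi (U j) fun Y =>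
      isNull (max i j) A B Y ⇾
        isEquiv (max i j) (null i A B X ⇾ Y) (X ⇾ Y)
          (lam (null i A B X ⇾ Y) fun g => lam X fun x => g ⋄ (eta i A B X ⋄ x))

end Ann

/-- A constant carrying the level `i` can be used at the level `j` if `i < j`. -/
def Const.levelOk (c : Const) (j : ℕ) : Bool :=
  match c with
  | .gen i | .genOf i | .genUnit i | .genSig i | .genEq i | .genRec i => i.blt j
  | _ => true

/-- The given types mention `max (φ k + 1) (φ j)` where the annotated ones have `j`; for `k < j`
strict monotonicity makes the maximum `φ j`. This is where the hypothesis `i < m` is used in the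
end. -/
theorem toTm_constType {φ : ℕ → ℕ} (hφ : StrictMono φ) {c : Const} {i j : ℕ}
    (h : c.levelOk j = true) :
    (Ann.constType i j c 0).toTm φ = constTy (c.map φ) (φ i) (φ j) := by
  have key (k : ℕ) (h : k.blt j = true) : max (φ k + 1) (φ j) = φ j :=
    max_eq_right (hφ (by simpa using h))
  cases c with
  | gen k | genOf k | genUnit k | genSig k | genEq k | genRec k =>
    have := key k h
    simp only [constTy, HoTT.constType, Const.map, this]
    rfl
  | _ => rfl

/-! ### The type checker -/

namespace Pre

/-- The level of a universe, up to reduction. -/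
def level (n : ℕ) (T : Pre) : Option ℕ :=
  match whnf n T with
  | univ i => some i
  | _ => none

/-- Conversion of types, up to cumulativity of universes. -/
def subtype (n : ℕ) (T T' : Pre) : Bool :=
  conv n T T' ||
    match level n T, level n T' with
    | some i, some j => i.ble j
    | _, _ => false

section
variable (ok : Const → ℕ → ℕ → Bool)

mutual

/-- Type inference, where `ok c i j` tells whether the constant `c` may be used at the levels
`i` and `j`. -/
def infer : ℕ → List Pre → Pre → Option Pre
  | 0, _, _ => none
  | n + 1, Γ, t =>
    match t with
    | var k =>
      match Γ[k]? with
      | some A => some (A.lift (k + 1) 0)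
      | none => none
    | univ i => some (univ (i + 1))
    | cst c i j => bif ok c i j then some (Ann.constType i j c 0) else none
    | pi A B =>
      match inferLevel n Γ A, inferLevel n (A :: Γ) B with
      | some i, some j => some (univ (max i j))
      | _, _ => none
    | lam A b =>
      match inferLevel n Γ A, infer n (A :: Γ) b with
      | some _, some B => some (pi A B)
      | _, _ => none
    | app f a =>
      match infer n Γ f with
      | some F =>
        match asPi n Γ F with
        | some (A, B) => bif check n Γ a A then some (inst a B 0) else none
        | none => none
      | none => none
termination_by structural n => n

/-- The level of a type. -/
def inferLevel : ℕ → List Pre → Pre → Option ℕ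
  | 0, _, _ => none
  | n + 1, Γ, A =>
    match infer n Γ A with
    | some T => level n T
    | none => none
termination_by structural n => n

/-- A type as a dependent product. -/
def asPi : ℕ → List Pre → Pre → Option (Pre × Pre)
  | 0, _, _ => none
  | n + 1, Γ, F =>
    match F with
    | pi A B => some (A, B)
    | F =>
      match whnf n F with
      | pi A B =>
        -- Subject reduction is not available, so the reduct is checked afresh; the application rule
        -- needs its domain and codomain to be types.
        match inferLevel n Γ (pi A B) with
        | some _ => some (A, B)
        | none => none
      | _ => none
termination_by structural n => n

/-- Type checking against a given type. -/
def check : ℕ → List Pre → Pre → Pre → Bool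
  | 0, _, _, _ => false
  | n + 1, Γ, t, T =>
    match t with
    | lam A b =>
      match asPi n Γ T with
      | some (A', B) =>
        match inferLevel n Γ A with
        | some _ => conv n A A' && check n (A :: Γ) b B
        | none => false
      | none => false
    | t =>
      match infer n Γ t with
      | some T' => subtype n T' T
      | none => false
termination_by structural n => n

end
end

-- Soundness of the type checker.

theorem level_sound (φ : ℕ → ℕ) {n : ℕ} {T : Pre} {i : ℕ} (h : level n T = some i) :
    Conv (T.toTm φ) (.univ (φ i)) := by
  unfold level at h
  have := conv_whnf φ n T
  split at h
  · rename_i e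
    cases h
    rwa [e] at this
  · cases h

/-- `A` is a type in the context `Γ`. -/
def IsType (Γ : List Tm) (A : Tm) : Prop := ∃ k, Der Γ A (.univ k)

/-- All entries of the context `Γ` are types. -/
def CtxOk (Γ : List Tm) : Prop := ∀ n A, Lookup Γ n A → IsType Γ A

theorem ctxOk_nil : CtxOk [] := fun _ _ h => by cases h

theorem CtxOk.cons {Γ : List Tm} (h : CtxOk Γ) {A : Tm} (hA : IsType Γ A) : CtxOk (A :: Γ) := by
  intro n B hB
  cases hB with
  | zero => exact hA.imp fun _ h => h.wk A
  | succ _ hB => exact (h _ _ hB).imp fun _ h => h.wk A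

theorem subtype_sound {φ : ℕ → ℕ} (hφ : StrictMono φ) {Γ : List Tm} {n : ℕ} {t : Tm} {T T' : Pre}
    (h : subtype n T T' = true) (ht : Der Γ t (T.toTm φ)) (hT' : IsType Γ (T'.toTm φ)) :
    Der Γ t (T'.toTm φ) := by
  obtain ⟨k, hk⟩ := hT'
  rw [subtype, Bool.or_eq_true] at h
  rcases h with h | h
  · exact .conv ht (conv_sound φ h) hk
  split at h
  · rename_i e e'
    have h1 := Der.conv ht (level_sound φ e) (.univ _ _)
    exact .conv (h1.cumul_le (hφ.monotone (by simpa using h))) (level_sound φ e').symm hk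
  · cases h

theorem lookup_toTm (φ : ℕ → ℕ) {Γ : List Pre} {k : ℕ} {A : Pre} (h : Γ[k]? = some A) :
    Lookup (Γ.map (toTm φ)) k ((A.lift (k + 1) 0).toTm φ) := by
  rw [toTm_lift]
  induction Γ generalizing k with
  | nil => simp at h
  | cons B Γ ih =>
    cases k with
    | zero =>
      simp only [List.getElem?_cons_zero, Option.some.injEq] at h
      subst h
      exact .zero _ _
    | succ k =>
      have := Lookup.succ (B.toTm φ) (ih (by simpa using h))
      rw [Tm.wk, Tm.ren_ren] at this
      exact this

theorem der_of_closed {t A : Tm} (h : Der [] t A) (Γ : List Tm) : Der Γ t A := by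
  have := h.ren (Δ := Γ) (ρ := fun n => n) fun _ _ hl => by cases hl
  simpa only [Tm.ren_eq_sub, Tm.sub_var] using this

/-- The constants accepted by `ok` have a well-formed type. -/
def Accepts (φ : ℕ → ℕ) (ok : Const → ℕ → ℕ → Bool) : Prop :=
  ∀ c i j, ok c i j = true →
    c.levelOk j = true ∧ IsType [] ((Ann.constType i j c 0).toTm φ)

section
variable {φ : ℕ → ℕ} {ok : Const → ℕ → ℕ → Bool}

/-- Soundness of the type checker with a given bound. -/
structure Sound (φ : ℕ → ℕ) (ok : Const → ℕ → ℕ → Bool) (n : ℕ) : Prop where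
  infer : ∀ {Γ : List Pre} {t A : Pre}, infer ok n Γ t = some A → CtxOk (Γ.map (toTm φ)) →
    Der (Γ.map (toTm φ)) (t.toTm φ) (A.toTm φ) ∧ IsType (Γ.map (toTm φ)) (A.toTm φ)
  inferLevel : ∀ {Γ : List Pre} {A : Pre} {i : ℕ}, inferLevel ok n Γ A = some i →
    CtxOk (Γ.map (toTm φ)) → Der (Γ.map (toTm φ)) (A.toTm φ) (.univ (φ i))
  asPi : ∀ {Γ : List Pre} {F A B : Pre}, asPi ok n Γ F = some (A, B) → CtxOk (Γ.map (toTm φ)) →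
    IsType (Γ.map (toTm φ)) (F.toTm φ) → Conv (F.toTm φ) (.pi (A.toTm φ) (B.toTm φ)) ∧
      IsType (Γ.map (toTm φ)) (.pi (A.toTm φ) (B.toTm φ))
  check : ∀ {Γ : List Pre} {t T : Pre}, check ok n Γ t T = true → CtxOk (Γ.map (toTm φ)) →
    IsType (Γ.map (toTm φ)) (T.toTm φ) → Der (Γ.map (toTm φ)) (t.toTm φ) (T.toTm φ)

theorem sound_infer_succ (hφ : StrictMono φ) (hok : Accepts φ ok) {n : ℕ} (ih : Sound φ ok n)
    {Γ : List Pre} {t A : Pre} (h : infer ok (n + 1) Γ t = some A) (hΓ : CtxOk (Γ.map (toTm φ))) :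
    Der (Γ.map (toTm φ)) (t.toTm φ) (A.toTm φ) ∧ IsType (Γ.map (toTm φ)) (A.toTm φ) := by
  rw [infer.eq_def] at h
  dsimp only at h
  split at h
  · split at h
    · rename_i e
      cases h
      have := lookup_toTm φ e
      exact ⟨.var this, hΓ _ _ this⟩
    · cases h
  · cases h
    -- Consecutive codes may denote levels far apart: only `φ i + 1 ≤ φ (i + 1)` holds, and
    -- cumulativity bridges the gap.
    exact ⟨(Der.univ _ _).cumul_le (hφ (Nat.lt_succ_self _)), _, .univ _ _⟩
  · rename_i c i j
    rcases hc : ok c i j with _ | _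
    · simp [hc] at h
    · simp only [hc, cond_true, Option.some.injEq] at h
      subst h
      obtain ⟨h1, k, h2⟩ := hok c i j hc
      refine ⟨?_, k, der_of_closed h2 _⟩
      rw [toTm_constType hφ h1]
      exact .cst _ _ _ _
  · split at h
    · rename_i e e'
      cases h
      have hA := ih.inferLevel e hΓ
      have hB := ih.inferLevel e' (hΓ.cons ⟨_, hA⟩)
      exact ⟨.pi (hA.cumul_le (hφ.monotone (le_max_left _ _)))
        (hB.cumul_le (hφ.monotone (le_max_right _ _))), _, .univ _ _⟩
    · cases h
  · split at h
    · rename_i i _ e e'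
      cases h
      have hA := ih.inferLevel e hΓ
      obtain ⟨hb, k, hB⟩ := ih.infer e' (hΓ.cons ⟨_, hA⟩)
      have hA' := hA.cumul_le (le_max_left _ k)
      have hB' := hB.cumul_le (le_max_right (φ i) k)
      exact ⟨.lam hA' hB' hb, _, .pi hA' hB'⟩
    · cases h
  · split at h
    · rename_i f a _ F e
      obtain ⟨hf, hF⟩ := ih.infer e hΓ
      split at h
      · rename_i A' B e'
        obtain ⟨hc, k, hpi⟩ := ih.asPi e' hΓ hF
        obtain ⟨l, hA, hB⟩ := hpi.pi_inv
        rcases hch : check ok n Γ a A' with _ | _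
        · simp [hch] at h
        · simp only [hch, cond_true, Option.some.injEq] at h
          subst h
          have ha := ih.check hch hΓ ⟨_, hA⟩
          rw [toTm_inst_zero]
          exact ⟨.app (.conv hf hc hpi) ha, l, hB.inst ha⟩
      · cases h
    · cases h

theorem sound (hφ : StrictMono φ) (hok : Accepts φ ok) (n : ℕ) : Sound φ ok n := by
  induction n with
  | zero =>
    refine ⟨?_, ?_, ?_, ?_⟩
    · intro _ _ _ h; cases h
    · intro _ _ _ h; cases h
    · intro _ _ _ _ h; cases h
    · intro _ _ _ h; cases h
  | succ n ih =>
    refine ⟨sound_infer_succ hφ hok ih, ?_, ?_, ?_⟩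
    · intro Γ A i h hΓ
      rw [Pre.inferLevel.eq_def] at h
      dsimp only at h
      split at h
      · rename_i e
        exact .conv (ih.infer e hΓ).1 (level_sound φ h) (.univ _ _)
      · cases h
    · intro Γ F A B h hΓ hF
      rw [Pre.asPi.eq_def] at h
      dsimp only at h
      split at h
      · cases h
        exact ⟨.rfl _, hF⟩
      · have hw := conv_whnf φ n F
        split at h
        · rename_i e
          split at h
          · rename_i e'
            cases h
            rw [e] at hw
            exact ⟨hw, _, ih.inferLevel e' hΓ⟩
          · cases h
        · cases h
    · intro Γ t T h hΓ hT
      rw [Pre.check.eq_def] at h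
      dsimp only at h
      split at h
      · split at h
        · rename_i e
          obtain ⟨hc, k, hpi⟩ := ih.asPi e hΓ hT
          obtain ⟨l, hA', hB⟩ := hpi.pi_inv
          split at h
          · rename_i e'
            rw [Bool.and_eq_true] at h
            have hA := ih.inferLevel e' hΓ
            have hAA' := conv_sound φ h.1
            have hB := hB.conv_ctx hAA' hA'
            have hb := ih.check h.2 (hΓ.cons ⟨_, hA⟩) ⟨_, hB⟩
            obtain ⟨k', hT⟩ := hT
            refine .conv (.lam (hA.cumul_le (le_max_left _ l))
              (hB.cumul_le (le_max_right _ l)) hb) ?_ hT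
            exact .trans (.pi hAA' (.rfl _)) hc.symm
          · cases h
        · cases h
      · split at h
        · rename_i e
          exact subtype_sound hφ h (ih.infer e hΓ).1 hT
        · cases h

-- Well-formedness of the types of the constants.

/-- The constants with number below `N`, at levels at most `2`. Constants that carry a level are
accepted only for the code `0`, and univalence only for `1`. -/
def allowed (N : ℕ) (c : Const) (i j : ℕ) : Bool :=
  c.code.1.blt N && i.ble 2 && j.ble 2 && c.levelOk j &&
    match c with
    | .univalence k => k.beq 1
    | .gen k | .genOf k | .genUnit k | .genSig k | .genEq k | .genRec k => k.beq 0
    | _ => true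

/-- The constants that the type checker accepts, in an order in which the type of each one uses
only previous ones. -/
def constants : List Const :=
  [.unit, .star, .unitInd, .sig, .pair, .sigInd, .id, .refl, .idInd, .funext, .trunc, .tr,
    .truncEq, .truncRec, .null, .eta, .nullIsNull, .nullRec, .univalence 1, .gen 0, .genOf 0,
    .genUnit 0, .genSig 0, .genEq 0, .genRec 0]

/-- Well-formedness of the type of a constant, checked at all accepted levels. -/
def checkConst (n : ℕ) (c : Const) : Bool :=
  [0, 1, 2].all fun i => [0, 1, 2].all fun j =>
    !c.levelOk j || (inferLevel (allowed c.code.1) n [] (Ann.constType i j c 0)).isSome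

theorem checkConst_of_mem {c : Const} (hc : c ∈ constants) : checkConst 200 c = true := by
  have : constants.all (checkConst 200) = true := by decide +kernel
  exact List.all_eq_true.1 this c hc

/-- Soundness of the checker presupposes well-formed types for the constants, and these types are
themselves checked. There is no circle: the type of a constant is checked using only constants of
smaller number, which the induction covers. -/
theorem accepts_allowed (hφ : StrictMono φ) (N : ℕ) : Accepts φ (allowed N) := by
  induction N using Nat.strong_induction_on with
  | _ N ih =>
    intro c i j h
    simp only [allowed, Bool.and_eq_true, Nat.ble_eq, Nat.blt_eq] at h
    obtain ⟨⟨⟨⟨hN, hi⟩, hj⟩, hl⟩, hc⟩ := h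
    refine ⟨hl, ?_⟩
    have hmem : c ∈ constants := by
      cases c <;> simp_all [constants]
    have := checkConst_of_mem hmem
    simp only [checkConst, List.all_eq_true] at this
    have := this i (by simp; omega) j (by simp; omega)
    rw [hl, Bool.not_true, Bool.false_or] at this
    obtain ⟨k, hk⟩ := Option.isSome_iff_exists.1 this
    exact ⟨_, (sound hφ (ih _ hN) 200).inferLevel hk ctxOk_nil⟩

-- From checked lemmas to closed terms.

/-- The context formed by a sequence of statements, given together with their proofs, and latest
first. -/
def context : List (Ann.Exp × Ann.Exp) → List Pre
  | [] => []
  | p :: l => p.1 l.length :: context l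

/-- Well-typedness of a statement and its proof, which may use the statements in `l`, as
variables. -/
def checkLemma (n : ℕ) (l : List (Ann.Exp × Ann.Exp)) (p : Ann.Exp × Ann.Exp) : Bool :=
  (inferLevel (allowed 25) n (context l) (p.1 l.length)).isSome &&
    check (allowed 25) n (context l) (p.2 l.length) (p.1 l.length)

/-- Well-typedness of a sequence of statements with their proofs. -/
def Checked (n : ℕ) : List (Ann.Exp × Ann.Exp) → Prop
  | [] => True
  | p :: l => checkLemma n l p = true ∧ Checked n l

theorem der_of_checkLemma (hφ : StrictMono φ) {n : ℕ} {l : List (Ann.Exp × Ann.Exp)}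
    {p : Ann.Exp × Ann.Exp} (h : checkLemma n l p = true)
    (hΓ : CtxOk ((context l).map (toTm φ))) :
    IsType ((context l).map (toTm φ)) ((p.1 l.length).toTm φ) ∧
      Der ((context l).map (toTm φ)) ((p.2 l.length).toTm φ) ((p.1 l.length).toTm φ) := by
  rw [checkLemma, Bool.and_eq_true] at h
  obtain ⟨k, hk⟩ := Option.isSome_iff_exists.1 h.1
  have hs := sound hφ (accepts_allowed hφ 25) n
  have hA := hs.inferLevel hk hΓ
  exact ⟨⟨_, hA⟩, hs.check h.2 hΓ ⟨_, hA⟩⟩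

/-- Given closed terms for the earlier lemmas, substituting them in the next proof closes it too. -/
theorem Checked.realizes (hφ : StrictMono φ) {n : ℕ} {l : List (Ann.Exp × Ann.Exp)}
    (h : Checked n l) : CtxOk ((context l).map (toTm φ)) ∧
      ∃ σ, Realizes [] ((context l).map (toTm φ)) σ := by
  induction l with
  | nil => exact ⟨ctxOk_nil, .var, fun _ _ h => by cases h⟩
  | cons p l ih =>
    obtain ⟨hΓ, σ, hσ⟩ := ih h.2
    obtain ⟨hA, ht⟩ := der_of_checkLemma hφ h.1 hΓ
    exact ⟨hΓ.cons hA, _, hσ.cons (ht.sub hσ)⟩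

theorem Checked.exists_der (hφ : StrictMono φ) {n : ℕ} {l : List (Ann.Exp × Ann.Exp)}
    {p : Ann.Exp × Ann.Exp} (h : Checked n (p :: l)) :
    ∃ (σ : ℕ → Tm) (t : Tm), Der [] t (((p.1 l.length).toTm φ).sub σ) := by
  obtain ⟨hΓ, σ, hσ⟩ := Checked.realizes hφ h.2
  exact ⟨σ, _, (der_of_checkLemma hφ h.1 hΓ).2.sub hσ⟩

end
end Pre
/-! ### The development inside homotopy type theory -/

namespace Ann

/-! #### Operations on paths, at the level `2` -/

/-- Level `2` serves the lower levels as well: types are cumulative, and annotations vanish in raw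
terms, so for instance `isEquiv 1` and `isEquiv 2` denote the same term. -/
def sym (A x y p : Exp) : Exp :=
  pathInd 2 2 A (fun x y _ => eq 2 A y x) (fun x => refl 2 A x) x y p

/-- Composition of `p : x = y` and `q : y = z`, by induction on `p`. -/
def trans (A x y z p q : Exp) : Exp :=
  pathInd 2 2 A (fun x y _ => eq 2 A y z ⇾ eq 2 A x z) (fun x => idfun (eq 2 A x z)) x y p ⋄ q

/-- Composition of `p : x = y` and `q : y = z`, by induction on `q`. -/
def trans' (A x y z p q : Exp) : Exp :=
  pathInd 2 2 A (fun y z _ => eq 2 A x y ⇾ eq 2 A x z) (fun y => idfun (eq 2 A x y)) y z q ⋄ p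

def cong (A B : Exp) (f : Exp → Exp) (x y p : Exp) : Exp :=
  pathInd 2 2 A (fun x y _ => eq 2 B (f x) (f y)) (fun x => refl 2 B (f x)) x y p

/-- `X` is null for the single type `P`. -/
def nul (X P : Exp) : Exp := isEquiv 1 X (P ⇾ X) (lam X fun x => lam P fun _ => x)

/-- Types under `X`. -/
def under (X : Exp) : Exp := sig 2 (U 1) fun Z => X ⇾ Z

/-- The type `Z` under `X`, with `f : X ⇒ Z`. -/
def underMk (X Z f : Exp) : Exp := mk 2 (U 1) (fun Z => X ⇾ Z) Z f

/-- The composite of `f : X ⇒ Z` with an equivalence. -/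
def equivComp (X Z Z' e f : Exp) : Exp :=
  lam X fun x => fst 1 (Z ⇾ Z') (fun f => isEquiv 1 Z Z' f) e ⋄ (f ⋄ x)

def modalityData : Exp :=
  sig 2 (U 1 ⇾ U 1) fun _M => sig 2 (U 1 ⇾ U 1) fun O => pi (U 1) fun X => X ⇾ O ⋄ X

def modalityMk (M O η : Exp) : Exp :=
  mk 2 (U 1 ⇾ U 1) (fun _ => sig 2 (U 1 ⇾ U 1) fun O => pi (U 1) fun X => X ⇾ O ⋄ X)
    M (mk 2 (U 1 ⇾ U 1) (fun O => pi (U 1) fun X => X ⇾ O ⋄ X) O η)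

def nullification (A B : Exp) : Exp :=
  modalityMk (lam (U 1) fun X => isNull 1 A B X) (lam (U 1) fun X => null 1 A B X)
    (lam (U 1) fun X => eta 1 A B X)

def sheafification (I T : Exp) : Exp := nullification I (lam I fun x => trunc 1 (T ⋄ x))

def generatedIndex (I T : Exp) : Exp := sig 1 (U 0) fun X => gen 0 1 I T X

def generated (I T : Exp) : Exp :=
  lam (generatedIndex I T) fun p => fst 1 (U 0) (fun X => gen 0 1 I T X) p

/-! #### References to the lemmas

The lemmas are variables, numbered in the order in which they are proved. -/

namespace Lemma

def cancel : Exp := bound 0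
def isoIsEquiv : Exp := bound 1
def equivInjective : Exp := bound 2
def equivFiber : Exp := bound 3
def propIsSet : Exp := bound 4
def propPi : Exp := bound 5
def propContr : Exp := bound 6
def propEquiv : Exp := bound 7
def univalencePath : Exp := bound 8
def propExt : Exp := bound 9
def underPath : Exp := bound 10
def underEq : Exp := bound 11
def pairEq : Exp := bound 12
def nulIntro : Exp := bound 13
def nulValue : Exp := bound 14
def nulSeparated : Exp := bound 15
def nulMono : Exp := bound 16
def nulLocal : Exp := bound 17
def nulUnit : Exp := bound 18
def nulSum : Exp := bound 19
def nulGen : Exp := bound 20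
def nullExtend : Exp := bound 21
def nullInverse : Exp := bound 22
def nullEq : Exp := bound 23
def nullificationEq : Exp := bound 24

end Lemma

/-! #### Equivalences -/

/-- `p ∙ (p⁻¹ ∙ q) = q`. -/
def cancel : Exp × Exp :=
  (pi (U 2) fun A => pi A fun x => pi A fun y => pi A fun z =>
    pi (eq 2 A x y) fun p => pi (eq 2 A x z) fun q =>
      eq 2 (eq 2 A x z) (trans' A x y z p (trans A y x z (sym A x y p) q)) q,
   lam (U 2) fun A => lam A fun x => lam A fun y => lam A fun z =>
    lam (eq 2 A x y) fun p =>
      pathInd 2 2 A (fun x y p => pi (eq 2 A x z) fun q =>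
          eq 2 (eq 2 A x z) (trans' A x y z p (trans A y x z (sym A x y p) q)) q)
        -- For `p` reflexivity, `sym` and `trans` compute away; `trans'` does not until `q` is also
        -- reflexivity.
        (fun x => lam (eq 2 A x z) fun q =>
          pathInd 2 2 A (fun x z q => eq 2 (eq 2 A x z) (trans' A x x z (refl 2 A x) q) q)
            (fun x => refl 2 (eq 2 A x x) (refl 2 A x)) x z q)
        x y p)

/-- A function with a quasi-inverse is an equivalence. -/
def isoIsEquiv : Exp × Exp :=
  (pi (U 2) fun A => pi (U 2) fun B => pi (A ⇾ B) fun f => pi (B ⇾ A) fun g =>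
    (pi A fun x => eq 2 A (g ⋄ (f ⋄ x)) x) ⇾ (pi B fun y => eq 2 B (f ⋄ (g ⋄ y)) y) ⇾
      isEquiv 2 A B f,
   lam (U 2) fun A => lam (U 2) fun B => lam (A ⇾ B) fun f => lam (B ⇾ A) fun g =>
    lam (pi A fun x => eq 2 A (g ⋄ (f ⋄ x)) x) fun η =>
    lam (pi B fun y => eq 2 B (f ⋄ (g ⋄ y)) y) fun ε =>
    lam B fun y =>
      let P := fun y x : Exp => eq 2 B (f ⋄ x) y
      let F := fun y : Exp => fib 2 A B f y
      let pr := fun y x p : Exp => mk 2 A (P y) x p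
      mk 2 (F y) (fun w => pi (F y) fun w' => eq 2 (F y) w w') (pr y (g ⋄ y) (ε ⋄ y))
        (uncurry 2 2 A (P y) (fun w => eq 2 (F y) (pr y (g ⋄ y) (ε ⋄ y)) w) fun x p =>
          -- No triangle identity relates `η` and `ε`. Instead `r` is chosen so that `ε (f x) ∙ r =
          -- s` by `cancel`. The centre equals `(u, t)` by induction on `r` (`trans'` computes at
          -- reflexivity), then `t = s`, and `(u, s) = (x, p)` by induction on `η x`.
          let u := g ⋄ (f ⋄ x)
          let ap := fun u x e : Exp => cong A B (fun a => f ⋄ a) u x e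
          let s := trans B (f ⋄ u) (f ⋄ x) y (ap u x (η ⋄ x)) p
          let r := trans B (f ⋄ x) (f ⋄ u) y (sym B (f ⋄ u) (f ⋄ x) (ε ⋄ (f ⋄ x))) s
          let t := trans' B (f ⋄ u) (f ⋄ x) y (ε ⋄ (f ⋄ x)) r
          trans (F y) (pr y (g ⋄ y) (ε ⋄ y)) (pr y u t) (pr y x p)
            (pathInd 2 2 B (fun b y r => eq 2 (F y) (pr y (g ⋄ y) (ε ⋄ y))
                (pr y (g ⋄ b) (trans' B (f ⋄ (g ⋄ b)) b y (ε ⋄ b) r)))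
              (fun b => refl 2 (F b) (pr b (g ⋄ b) (ε ⋄ b))) (f ⋄ x) y r)
            (trans (F y) (pr y u t) (pr y u s) (pr y x p)
              (cong (P y u) (F y) (fun q => pr y u q) t s
                (Lemma.cancel ⋄ B ⋄ (f ⋄ u) ⋄ (f ⋄ x) ⋄ y ⋄ (ε ⋄ (f ⋄ x)) ⋄ s))
              (pathInd 2 2 A (fun u x e => pi (P y x) fun p =>
                  eq 2 (F y) (pr y u (trans B (f ⋄ u) (f ⋄ x) y (ap u x e) p)) (pr y x p))
                (fun x => lam (P y x) fun p => refl 2 (F y) (pr y x p)) u x (η ⋄ x) ⋄ p))))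

/-- An equivalence is injective. -/
def equivInjective : Exp × Exp :=
  (pi (U 2) fun A => pi (U 2) fun B => pi (A ⇾ B) fun f => isEquiv 2 A B f ⇾
    pi A fun x => pi A fun y => eq 2 B (f ⋄ x) (f ⋄ y) ⇾ eq 2 A x y,
   lam (U 2) fun A => lam (U 2) fun B => lam (A ⇾ B) fun f => lam (isEquiv 2 A B f) fun e =>
    lam A fun x => lam A fun y => lam (eq 2 B (f ⋄ x) (f ⋄ y)) fun p =>
      let P := fun x : Exp => eq 2 B (f ⋄ x) (f ⋄ y)
      let F := fib 2 A B f (f ⋄ y)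
      let Q := fun w : Exp => pi F fun w' => eq 2 F w w'
      let c := fst 2 F Q (e ⋄ (f ⋄ y))
      let h := snd 2 F Q (e ⋄ (f ⋄ y))
      -- Both `x` and `y` give points of the fibre over `f y`, which is contractible.
      let v := mk 2 A P x p
      let w := mk 2 A P y (refl 2 B (f ⋄ y))
      cong F A (fun w => fst 2 A P w) v w (trans F v c w (sym F c v (h ⋄ v)) (h ⋄ w)))

/-- The fibres of an equivalence are inhabited. -/
def equivFiber : Exp × Exp :=
  (pi (U 2) fun A => pi (U 2) fun B => pi (A ⇾ B) fun f => isEquiv 2 A B f ⇾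
    pi B fun y => fib 2 A B f y,
   lam (U 2) fun A => lam (U 2) fun B => lam (A ⇾ B) fun f => lam (isEquiv 2 A B f) fun e =>
    lam B fun y =>
      let F := fib 2 A B f y
      fst 2 F (fun w => pi F fun w' => eq 2 F w w') (e ⋄ y))

/-! #### Mere propositions -/

/-- The identity types of a mere proposition are mere propositions. -/
def propIsSet : Exp × Exp :=
  (pi (U 2) fun A => isProp 2 A ⇾ pi A fun x => pi A fun y => isProp 2 (eq 2 A x y),
   lam (U 2) fun A => lam (isProp 2 A) fun h => lam A fun x => lam A fun y =>
    lam (eq 2 A x y) fun p => lam (eq 2 A x y) fun q =>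
      -- A path from `x` to `y` independent of `p`; normalizing by `h x x` makes it trivial when `y`
      -- is `x`, so every `p` equals it by path induction.
      let k := fun x y : Exp => trans A x x y (sym A x x (h ⋄ x ⋄ x)) (h ⋄ x ⋄ y)
      let c := fun p : Exp => pathInd 2 2 A (fun x y p => eq 2 (eq 2 A x y) p (k x y))
        (fun x => pathInd 2 2 A
          (fun a b u => eq 2 (eq 2 A b b) (refl 2 A b) (trans A b a b (sym A a b u) u))
          (fun a => refl 2 (eq 2 A a a) (refl 2 A a)) x x (h ⋄ x ⋄ x)) x y p
      trans (eq 2 A x y) p (k x y) q (c p) (sym (eq 2 A x y) q (k x y) (c q)))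

/-- A product of mere propositions is a mere proposition. -/
def propPi : Exp × Exp :=
  (pi (U 2) fun A => pi (A ⇾ U 2) fun B => (pi A fun x => isProp 2 (B ⋄ x)) ⇾
    isProp 2 (pi A fun x => B ⋄ x),
   lam (U 2) fun A => lam (A ⇾ U 2) fun B => lam (pi A fun x => isProp 2 (B ⋄ x)) fun h =>
    lam (pi A fun x => B ⋄ x) fun f => lam (pi A fun x => B ⋄ x) fun g =>
      con .funext 2 2 ⋄ A ⋄ B ⋄ f ⋄ g ⋄ (lam A fun x => h ⋄ x ⋄ (f ⋄ x) ⋄ (g ⋄ x)))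

/-- The contraction `h` joins the two centres. After induction on that path the second components
are functions into identity types of `A`, and these are propositions because `h` makes `A` one. -/
def propContr : Exp × Exp :=
  (pi (U 2) fun A => isProp 2 (isContr 2 A),
   lam (U 2) fun A =>
    let Q := fun a : Exp => pi A fun x => eq 2 A a x
    let C := isContr 2 A
    let pr := fun a h : Exp => mk 2 A Q a h
    uncurry 2 2 A Q (fun v => pi C fun w => eq 2 C v w) fun a h =>
      uncurry 2 2 A Q (fun w => eq 2 C (pr a h) w) fun a' h' =>
        pathInd 2 2 A (fun a a' _ => pi (Q a) fun h => pi (Q a') fun h' =>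
            eq 2 C (pr a h) (pr a' h'))
          (fun a => lam (Q a) fun h => lam (Q a) fun h' =>
            cong (Q a) C (fun h => pr a h) h h'
              (Lemma.propPi ⋄ A ⋄ (lam A fun x => eq 2 A a x) ⋄
                (lam A fun x => Lemma.propIsSet ⋄ A ⋄
                  (lam A fun x => lam A fun y => trans A x a y (sym A a x (h ⋄ x)) (h ⋄ y)) ⋄
                  a ⋄ x) ⋄ h ⋄ h'))
          a a' (h ⋄ a') ⋄ h ⋄ h')

def propEquiv : Exp × Exp :=
  (pi (U 2) fun A => pi (U 2) fun B => pi (A ⇾ B) fun f => isProp 2 (isEquiv 2 A B f),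
   lam (U 2) fun A => lam (U 2) fun B => lam (A ⇾ B) fun f =>
    Lemma.propPi ⋄ B ⋄ (lam B fun y => isContr 2 (fib 2 A B f y)) ⋄
      (lam B fun y => Lemma.propContr ⋄ fib 2 A B f y))

/-! #### Consequences of univalence -/

/-- Every equivalence comes from a path. -/
def univalencePath : Exp × Exp :=
  (pi (U 1) fun Z => pi (U 1) fun Z' => pi (equiv 1 Z Z') fun e =>
    fib 2 (eq 2 (U 1) Z Z') (equiv 1 Z Z') (idToEquiv 1 Z Z') e,
   lam (U 1) fun Z => lam (U 1) fun Z' => Lemma.equivFiber ⋄ eq 2 (U 1) Z Z' ⋄ equiv 1 Z Z' ⋄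
    idToEquiv 1 Z Z' ⋄ (con (.univalence 1) 2 2 ⋄ Z ⋄ Z'))

def propExt : Exp × Exp :=
  (pi (U 1) fun P => pi (U 1) fun Q => isProp 1 P ⇾ isProp 1 Q ⇾ (P ⇾ Q) ⇾ (Q ⇾ P) ⇾
    eq 2 (U 1) P Q,
   lam (U 1) fun P => lam (U 1) fun Q => lam (isProp 1 P) fun hP => lam (isProp 1 Q) fun hQ =>
    lam (P ⇾ Q) fun f => lam (Q ⇾ P) fun g =>
      let e := mk 1 (P ⇾ Q) (fun f => isEquiv 1 P Q f) f
        (Lemma.isoIsEquiv ⋄ P ⋄ Q ⋄ f ⋄ g ⋄ (lam P fun x => hP ⋄ (g ⋄ (f ⋄ x)) ⋄ x) ⋄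
          (lam Q fun y => hQ ⋄ (f ⋄ (g ⋄ y)) ⋄ y))
      fst 2 (eq 2 (U 1) P Q) (fun p => eq 2 (equiv 1 P Q) (idToEquiv 1 P Q ⋄ p) e)
        (Lemma.univalencePath ⋄ P ⋄ Q ⋄ e))

/-- Transport of a type under `X` along a path. -/
def underPath : Exp × Exp :=
  (pi (U 1) fun X => pi (U 1) fun Z => pi (U 1) fun Z' => pi (eq 2 (U 1) Z Z') fun p =>
    pi (X ⇾ Z) fun f => eq 2 (under X) (underMk X Z f)
      (underMk X Z' (equivComp X Z Z' (idToEquiv 1 Z Z' ⋄ p) f)),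
   lam (U 1) fun X => lam (U 1) fun Z => lam (U 1) fun Z' => lam (eq 2 (U 1) Z Z') fun p =>
    pathInd 2 2 (U 1)
      (fun Z Z' p => pi (X ⇾ Z) fun f => eq 2 (under X) (underMk X Z f)
        (underMk X Z' (equivComp X Z Z' (idToEquiv 1 Z Z' ⋄ p) f)))
      -- At reflexivity `idToEquiv` computes to the identity, and the composite is `f` by eta.
      (fun Z => lam (X ⇾ Z) fun f => refl 2 (under X) (underMk X Z f)) Z Z' p)

/-- Equivalent types under `X` are equal. -/
def underEq : Exp × Exp :=
  (pi (U 1) fun X => pi (U 1) fun Z => pi (U 1) fun Z' => pi (equiv 1 Z Z') fun e =>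
    pi (X ⇾ Z) fun f => eq 2 (under X) (underMk X Z f) (underMk X Z' (equivComp X Z Z' e f)),
   lam (U 1) fun X => lam (U 1) fun Z => lam (U 1) fun Z' => lam (equiv 1 Z Z') fun e =>
    lam (X ⇾ Z) fun f =>
      let u := fun e : Exp => underMk X Z' (equivComp X Z Z' e f)
      split 2 2 (eq 2 (U 1) Z Z') (fun p => eq 2 (equiv 1 Z Z') (idToEquiv 1 Z Z' ⋄ p) e)
        (fun _ => eq 2 (under X) (underMk X Z f) (u e))
        (fun p q =>
          pathInd 2 2 (equiv 1 Z Z') (fun e e' _ => eq 2 (under X) (underMk X Z f) (u e) ⇾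
              eq 2 (under X) (underMk X Z f) (u e'))
            (fun e => idfun (eq 2 (under X) (underMk X Z f) (u e))) (idToEquiv 1 Z Z' ⋄ p) e q ⋄
          (Lemma.underPath ⋄ X ⋄ Z ⋄ Z' ⋄ p ⋄ f))
        (Lemma.univalencePath ⋄ Z ⋄ Z' ⋄ e))

def pairEq : Exp × Exp :=
  (pi (U 2) fun A => pi (U 2) fun B => pi A fun a => pi A fun a' => pi B fun b => pi B fun b' =>
    eq 2 A a a' ⇾ eq 2 B b b' ⇾
      eq 2 (sig 2 A fun _ => B) (mk 2 A (fun _ => B) a b) (mk 2 A (fun _ => B) a' b'),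
   lam (U 2) fun A => lam (U 2) fun B => lam A fun a => lam A fun a' => lam B fun b =>
    lam B fun b' => lam (eq 2 A a a') fun p => lam (eq 2 B b b') fun q =>
      let pr := fun a b : Exp => mk 2 A (fun _ => B) a b
      let S := sig 2 A fun _ => B
      trans S (pr a b) (pr a' b) (pr a' b') (cong A S (fun a => pr a b) a a' p)
        (cong B S (fun b => pr a' b) b b' q))

/-! #### Types that are null for a single type -/

/-- A criterion for `X` to be null for `Q`. -/
def nulIntro : Exp × Exp :=
  (pi (U 1) fun X => pi (U 1) fun Q => pi ((Q ⇾ X) ⇾ X) fun r =>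
    (pi (Q ⇾ X) fun f => pi Q fun q => eq 1 X (r ⋄ f) (f ⋄ q)) ⇾
    (pi X fun x => eq 1 X (r ⋄ lam Q fun _ => x) x) ⇾ nul X Q,
   lam (U 1) fun X => lam (U 1) fun Q => lam ((Q ⇾ X) ⇾ X) fun r =>
    lam (pi (Q ⇾ X) fun f => pi Q fun q => eq 1 X (r ⋄ f) (f ⋄ q)) fun h =>
    lam (pi X fun x => eq 1 X (r ⋄ lam Q fun _ => x) x) fun h' =>
      Lemma.isoIsEquiv ⋄ X ⋄ (Q ⇾ X) ⋄ (lam X fun x => lam Q fun _ => x) ⋄ r ⋄ h' ⋄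
        (lam (Q ⇾ X) fun f => con .funext 1 1 ⋄ Q ⋄ (lam Q fun _ => X) ⋄
          (lam Q fun _ => r ⋄ f) ⋄ f ⋄ (h ⋄ f)))

/-- Functions from `P` to a `P`-null type have values. -/
def nulValue : Exp × Exp :=
  (pi (U 1) fun X => pi (U 1) fun P => nul X P ⇾
    sig 1 ((P ⇾ X) ⇾ X) fun r => pi (P ⇾ X) fun f => pi P fun p => eq 1 X (r ⋄ f) (f ⋄ p),
   lam (U 1) fun X => lam (U 1) fun P => lam (nul X P) fun e =>
    let D := fun x : Exp => lam P fun _ => x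
    let s := fun f : Exp => Lemma.equivFiber ⋄ X ⋄ (P ⇾ X) ⋄ (lam X D) ⋄ e ⋄ f
    let W := fun f x : Exp => eq 1 (P ⇾ X) (lam X D ⋄ x) f
    let r := fun f : Exp => fst 1 X (W f) (s f)
    mk 1 ((P ⇾ X) ⇾ X)
      (fun r => pi (P ⇾ X) fun f => pi P fun p => eq 1 X (r ⋄ f) (f ⋄ p)) (lam (P ⇾ X) r)
      (lam (P ⇾ X) fun f => lam P fun p =>
        cong (P ⇾ X) X (fun f => f ⋄ p) (D (r f)) f (snd 1 X (W f) (s f))))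

/-- Elements of a `P`-null type that are equal under the hypothesis `P` are equal. -/
def nulSeparated : Exp × Exp :=
  (pi (U 1) fun X => pi (U 1) fun P => nul X P ⇾ pi X fun x => pi X fun y =>
    (P ⇾ eq 1 X x y) ⇾ eq 1 X x y,
   lam (U 1) fun X => lam (U 1) fun P => lam (nul X P) fun e => lam X fun x => lam X fun y =>
    lam (P ⇾ eq 1 X x y) fun h =>
      let D := fun x : Exp => lam P fun _ => x
      Lemma.equivInjective ⋄ X ⋄ (P ⇾ X) ⋄ (lam X D) ⋄ e ⋄ x ⋄ y ⋄
        (con .funext 1 1 ⋄ P ⋄ (lam P fun _ => X) ⋄ D x ⋄ D y ⋄ h))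

/-- The value of `f : P ⇒ X`, for a proof `e` that `X` is `P`-null. -/
def value (X P e f : Exp) : Exp :=
  fst 1 ((P ⇾ X) ⇾ X) (fun r => pi (P ⇾ X) fun f => pi P fun p => eq 1 X (r ⋄ f) (f ⋄ p))
    (Lemma.nulValue ⋄ X ⋄ P ⋄ e) ⋄ f

def valueEq (X P e f p : Exp) : Exp :=
  snd 1 ((P ⇾ X) ⇾ X) (fun r => pi (P ⇾ X) fun f => pi P fun p => eq 1 X (r ⋄ f) (f ⋄ p))
    (Lemma.nulValue ⋄ X ⋄ P ⋄ e) ⋄ f ⋄ p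

/-- A `P`-null type is null for every mere proposition implied by `P`. -/
def nulMono : Exp × Exp :=
  (pi (U 1) fun X => pi (U 1) fun P => pi (U 1) fun Q => isProp 1 Q ⇾ (P ⇾ Q) ⇾
    nul X P ⇾ nul X Q,
   lam (U 1) fun X => lam (U 1) fun P => lam (U 1) fun Q => lam (isProp 1 Q) fun hQ =>
    lam (P ⇾ Q) fun k => lam (nul X P) fun e =>
      -- The value of `f : Q ⇒ X` is that of its restriction along `k`. Both required equations may
      -- be proved under the hypothesis `P`, as `X` is `P`-separated.
      let g := fun f : Exp => lam P fun p => f ⋄ (k ⋄ p)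
      let r := fun f : Exp => value X P e (g f)
      Lemma.nulIntro ⋄ X ⋄ Q ⋄ (lam (Q ⇾ X) r) ⋄
        (lam (Q ⇾ X) fun f => lam Q fun q =>
          Lemma.nulSeparated ⋄ X ⋄ P ⋄ e ⋄ r f ⋄ (f ⋄ q) ⋄ lam P fun p =>
            trans X (r f) (f ⋄ (k ⋄ p)) (f ⋄ q) (valueEq X P e (g f) p)
              (cong Q X (fun q => f ⋄ q) (k ⋄ p) q (hQ ⋄ (k ⋄ p) ⋄ q))) ⋄
        (lam X fun x =>
          let f := lam Q fun _ => x
          Lemma.nulSeparated ⋄ X ⋄ P ⋄ e ⋄ r f ⋄ x ⋄ lam P fun p => valueEq X P e (g f) p))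

/-- If `Q` implies `P`, then a `P`-null type that is `Q`-null under the hypothesis `P` is
`Q`-null. -/
def nulLocal : Exp × Exp :=
  (pi (U 1) fun X => pi (U 1) fun P => pi (U 1) fun Q => (Q ⇾ P) ⇾
    nul X P ⇾ (P ⇾ nul X Q) ⇾ nul X Q,
   lam (U 1) fun X => lam (U 1) fun P => lam (U 1) fun Q =>
    lam (Q ⇾ P) fun k => lam (nul X P) fun e => lam (P ⇾ nul X Q) fun h =>
      -- Under `P` the map `f` has a value; these local values form a map `P ⇒ X`, whose own value
      -- is the one sought.
      let g := fun f : Exp => lam P fun p => value X Q (h ⋄ p) f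
      let r := fun f : Exp => value X P e (g f)
      Lemma.nulIntro ⋄ X ⋄ Q ⋄ (lam (Q ⇾ X) r) ⋄
        (lam (Q ⇾ X) fun f => lam Q fun q =>
          trans X (r f) (value X Q (h ⋄ (k ⋄ q)) f) (f ⋄ q) (valueEq X P e (g f) (k ⋄ q))
            (valueEq X Q (h ⋄ (k ⋄ q)) f q)) ⋄
        (lam X fun x =>
          let f := lam Q fun _ => x
          Lemma.nulSeparated ⋄ X ⋄ P ⋄ e ⋄ r f ⋄ x ⋄ lam P fun p =>
            trans X (r f) (value X Q (h ⋄ p) f) x (valueEq X P e (g f) p)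
              (Lemma.nulSeparated ⋄ X ⋄ Q ⋄ (h ⋄ p) ⋄ value X Q (h ⋄ p) f ⋄ x ⋄ lam Q fun q =>
                valueEq X Q (h ⋄ p) f q)))

def nulUnit : Exp × Exp :=
  (pi (U 1) fun X => nul X (trunc 1 (one 1)),
   lam (U 1) fun X =>
    let Q := trunc 1 (one 1)
    let c := con .tr 1 1 ⋄ one 1 ⋄ con .star 1 1
    Lemma.nulIntro ⋄ X ⋄ Q ⋄ (lam (Q ⇾ X) fun f => f ⋄ c) ⋄
      (lam (Q ⇾ X) fun f => lam Q fun q =>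
        cong Q X (fun q => f ⋄ q) c q (con .truncEq 1 1 ⋄ one 1 ⋄ c ⋄ q)) ⋄
      (lam X fun x => refl 1 X x))

/-- Truncation is eliminated twice: into `‖A‖`, and into nullness of `X`, which is a proposition by
`propEquiv`. The latter replaces the hypothesis `‖A‖` by an actual `a : A`, so that nullness for `‖B
a‖` can be used. -/
def nulSum : Exp × Exp :=
  (pi (U 1) fun X => pi (U 0) fun A => pi (A ⇾ U 0) fun B => nul X (trunc 1 A) ⇾
    (pi A fun a => nul X (trunc 1 (B ⋄ a))) ⇾ nul X (trunc 1 (sum 0 A B)),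
   lam (U 1) fun X => lam (U 0) fun A => lam (A ⇾ U 0) fun B => lam (nul X (trunc 1 A)) fun e =>
    lam (pi A fun a => nul X (trunc 1 (B ⋄ a))) fun h =>
      let S := sum 0 A B
      let P := trunc 1 A
      let Q := trunc 1 S
      Lemma.nulLocal ⋄ X ⋄ P ⋄ Q ⋄
        (con .truncRec 1 1 ⋄ S ⋄ P ⋄ (con .truncEq 1 1 ⋄ A) ⋄
          (con .sigInd 0 1 ⋄ A ⋄ B ⋄ (lam S fun _ => P) ⋄
            lam A fun a => lam (B ⋄ a) fun _ => con .tr 1 1 ⋄ A ⋄ a)) ⋄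
        e ⋄
        (con .truncRec 1 1 ⋄ A ⋄ nul X Q ⋄
          (Lemma.propEquiv ⋄ X ⋄ (Q ⇾ X) ⋄ lam X fun x => lam Q fun _ => x) ⋄
          lam A fun a => Lemma.nulMono ⋄ X ⋄ trunc 1 (B ⋄ a) ⋄ Q ⋄ (con .truncEq 1 1 ⋄ S) ⋄
            (con .truncRec 1 1 ⋄ (B ⋄ a) ⋄ Q ⋄ (con .truncEq 1 1 ⋄ S) ⋄
              lam (B ⋄ a) fun b => con .tr 1 1 ⋄ S ⋄ (con .pair 0 0 ⋄ A ⋄ B ⋄ a ⋄ b)) ⋄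
            (h ⋄ a)))

/-- A type that is null for the truncations of the types of a collection is null for the
truncations of the types of the presentation that it generates. -/
def nulGen : Exp × Exp :=
  (pi (U 1) fun I => pi (I ⇾ U 0) fun T => pi (U 1) fun X =>
    (pi I fun x => nul X (trunc 1 (T ⋄ x))) ⇾ pi (U 0) fun A => gen 0 1 I T A ⇾ nul X (trunc 1 A),
   lam (U 1) fun I => lam (I ⇾ U 0) fun T => lam (U 1) fun X =>
    lam (pi I fun x => nul X (trunc 1 (T ⋄ x))) fun h =>
      con (.genRec 0) 1 1 ⋄ I ⋄ T ⋄ (lam (U 0) fun A => nul X (trunc 1 A)) ⋄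
        (lam (U 0) fun A => Lemma.propEquiv ⋄ X ⋄ (trunc 1 A ⇾ X) ⋄
          lam X fun x => lam (trunc 1 A) fun _ => x) ⋄
        h ⋄ (Lemma.nulUnit ⋄ X) ⋄ (Lemma.nulSum ⋄ X))

/-! #### Nullifications -/

/-- Maps to a null type extend along the unit. -/
def nullExtend : Exp × Exp :=
  (pi (U 1) fun A => pi (A ⇾ U 1) fun B => pi (U 1) fun X => pi (U 1) fun Y =>
    isNull 1 A B Y ⇾ pi (X ⇾ Y) fun h => sig 1 (null 1 A B X ⇾ Y) fun k =>
      eq 1 (X ⇾ Y) (lam X fun x => k ⋄ (eta 1 A B X ⋄ x)) h,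
   lam (U 1) fun A => lam (A ⇾ U 1) fun B => lam (U 1) fun X => lam (U 1) fun Y =>
    lam (isNull 1 A B Y) fun n =>
      Lemma.equivFiber ⋄ (null 1 A B X ⇾ Y) ⋄ (X ⇾ Y) ⋄
        (lam (null 1 A B X ⇾ Y) fun g => lam X fun x => g ⋄ (eta 1 A B X ⋄ x)) ⋄
        (con .nullRec 1 1 ⋄ A ⋄ B ⋄ X ⋄ Y ⋄ n))

/-- Maps between two nullifications of `X` that commute with the units are inverse to each
other. -/
def nullInverse : Exp × Exp :=
  (pi (U 1) fun A => pi (A ⇾ U 1) fun B => pi (U 1) fun X =>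
    pi (U 1) fun Z => pi (X ⇾ Z) fun h =>
    pi (null 1 A B X ⇾ Z) fun k => pi (Z ⇾ null 1 A B X) fun k' =>
      eq 1 (X ⇾ Z) (lam X fun x => k ⋄ (eta 1 A B X ⋄ x)) h ⇾
      eq 1 (X ⇾ null 1 A B X) (lam X fun x => k' ⋄ (h ⋄ x)) (eta 1 A B X) ⇾
        pi (null 1 A B X) fun z => eq 1 (null 1 A B X) (k' ⋄ (k ⋄ z)) z,
   lam (U 1) fun A => lam (A ⇾ U 1) fun B => lam (U 1) fun X =>
    let N := null 1 A B X
    let η := eta 1 A B X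
    lam (U 1) fun Z => lam (X ⇾ Z) fun h => lam (N ⇾ Z) fun k => lam (Z ⇾ N) fun k' =>
    lam (eq 1 (X ⇾ Z) (lam X fun x => k ⋄ (η ⋄ x)) h) fun p =>
    lam (eq 1 (X ⇾ N) (lam X fun x => k' ⋄ (h ⋄ x)) η) fun p' => lam N fun z =>
      let k'k := lam N fun z => k' ⋄ (k ⋄ z)
      cong (N ⇾ N) N (fun g => g ⋄ z) k'k (idfun N)
        -- `N` is null for its own family, so endomaps of `N` are determined by their restriction
        -- along the unit. Nothing is asked of `Z`, so the same lemma gives the other composite with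
        -- the roles exchanged.
        (Lemma.equivInjective ⋄ (N ⇾ N) ⋄ (X ⇾ N) ⋄
          (lam (N ⇾ N) fun g => lam X fun x => g ⋄ (η ⋄ x)) ⋄
          (con .nullRec 1 1 ⋄ A ⋄ B ⋄ X ⋄ N ⋄ (con .nullIsNull 1 1 ⋄ A ⋄ B ⋄ X)) ⋄
          k'k ⋄ idfun N ⋄
          trans (X ⇾ N) (lam X fun x => k' ⋄ (k ⋄ (η ⋄ x))) (lam X fun x => k' ⋄ (h ⋄ x)) η
            (cong (X ⇾ Z) (X ⇾ N) (fun h => lam X fun x => k' ⋄ (h ⋄ x))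
              (lam X fun x => k ⋄ (η ⋄ x)) h p) p'))

/-- Nullifications that are null for each other's family are equal. -/
def nullEq : Exp × Exp :=
  (pi (U 1) fun A => pi (A ⇾ U 1) fun B => pi (U 1) fun A' => pi (A' ⇾ U 1) fun B' =>
    pi (U 1) fun X => isNull 1 A B (null 1 A' B' X) ⇾ isNull 1 A' B' (null 1 A B X) ⇾
      eq 2 (under X) (underMk X (null 1 A B X) (eta 1 A B X))
        (underMk X (null 1 A' B' X) (eta 1 A' B' X)),
   lam (U 1) fun A => lam (A ⇾ U 1) fun B => lam (U 1) fun A' => lam (A' ⇾ U 1) fun B' =>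
    lam (U 1) fun X =>
    let N := null 1 A B X
    let N' := null 1 A' B' X
    let η := eta 1 A B X
    let η' := eta 1 A' B' X
    let G := eq 2 (under X) (underMk X N η) (underMk X N' η')
    let W := fun k : Exp => eq 1 (X ⇾ N') (lam X fun x => k ⋄ (η ⋄ x)) η'
    let W' := fun k : Exp => eq 1 (X ⇾ N) (lam X fun x => k ⋄ (η' ⋄ x)) η
    lam (isNull 1 A B N') fun n => lam (isNull 1 A' B' N) fun n' =>
      -- Each unit extends along the other, which gives mutually inverse `k` and `k'`. The
      -- equivalence `k` carries `η` to `k ∘ η`, and `p` replaces the latter by `η'`.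
      split 2 2 (N ⇾ N') W (fun _ => G) (fun k p =>
        split 2 2 (N' ⇾ N) W' (fun _ => G) (fun k' p' =>
            let kη := lam X fun x => k ⋄ (η ⋄ x)
            trans (under X) (underMk X N η) (underMk X N' kη) (underMk X N' η')
              (Lemma.underEq ⋄ X ⋄ N ⋄ N' ⋄
                mk 1 (N ⇾ N') (fun f => isEquiv 1 N N' f) k
                  (Lemma.isoIsEquiv ⋄ N ⋄ N' ⋄ k ⋄ k' ⋄
                    (Lemma.nullInverse ⋄ A ⋄ B ⋄ X ⋄ N' ⋄ η' ⋄ k ⋄ k' ⋄ p ⋄ p') ⋄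
                    (Lemma.nullInverse ⋄ A' ⋄ B' ⋄ X ⋄ N ⋄ η ⋄ k' ⋄ k ⋄ p' ⋄ p)) ⋄ η)
              (cong (X ⇾ N') (under X) (fun h => underMk X N' h) kη η' p))
          (Lemma.nullExtend ⋄ A' ⋄ B' ⋄ X ⋄ N ⋄ n' ⋄ η))
        (Lemma.nullExtend ⋄ A ⋄ B ⋄ X ⋄ N' ⋄ n ⋄ η'))

/-- Reflector and unit are kept together, for each `X`, as one point of `under X`, paired with the
proposition of being null. This avoids transporting units along paths of reflectors: function
extensionality compares the resulting functions of `X`, and reading off their components computes to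
the modality data. -/
def nullificationEq : Exp × Exp :=
  (pi (U 1) fun A => pi (A ⇾ U 1) fun B => pi (U 1) fun A' => pi (A' ⇾ U 1) fun B' =>
    (pi (U 1) fun X => isNull 1 A B X ⇾ isNull 1 A' B' X) ⇾
    (pi (U 1) fun X => isNull 1 A' B' X ⇾ isNull 1 A B X) ⇾
      eq 2 modalityData (nullification A B) (nullification A' B'),
   lam (U 1) fun A => lam (A ⇾ U 1) fun B => lam (U 1) fun A' => lam (A' ⇾ U 1) fun B' =>
    lam (pi (U 1) fun X => isNull 1 A B X ⇾ isNull 1 A' B' X) fun f =>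
    lam (pi (U 1) fun X => isNull 1 A' B' X ⇾ isNull 1 A B X) fun g =>
      let K := fun X : Exp => sig 2 (U 1) fun _ => under X
      let k := fun A B X : Exp =>
        mk 2 (U 1) (fun _ => under X) (isNull 1 A B X) (underMk X (null 1 A B X) (eta 1 A B X))
      let pr := fun h X : Exp => snd 2 (U 1) (fun _ => under X) (h ⋄ X)
      let prop := fun A B X : Exp =>
        Lemma.propPi ⋄ A ⋄
          (lam A fun a => isEquiv 1 X (B ⋄ a ⇾ X) (lam X fun x => lam (B ⋄ a) fun _ => x)) ⋄
          (lam A fun a => Lemma.propEquiv ⋄ X ⋄ (B ⋄ a ⇾ X) ⋄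
            lam X fun x => lam (B ⋄ a) fun _ => x)
      cong (pi (U 1) K) modalityData
        (fun h => modalityMk (lam (U 1) fun X => fst 2 (U 1) (fun _ => under X) (h ⋄ X))
          (lam (U 1) fun X => fst 2 (U 1) (fun Z => X ⇾ Z) (pr h X))
          (lam (U 1) fun X => snd 2 (U 1) (fun Z => X ⇾ Z) (pr h X)))
        (lam (U 1) (k A B)) (lam (U 1) (k A' B'))
        (con .funext 2 2 ⋄ U 1 ⋄ lam (U 1) K ⋄ lam (U 1) (k A B) ⋄ lam (U 1) (k A' B') ⋄
          lam (U 1) fun X => Lemma.pairEq ⋄ U 1 ⋄ under X ⋄ isNull 1 A B X ⋄ isNull 1 A' B' X ⋄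
            underMk X (null 1 A B X) (eta 1 A B X) ⋄ underMk X (null 1 A' B' X) (eta 1 A' B' X) ⋄
            (Lemma.propExt ⋄ isNull 1 A B X ⋄ isNull 1 A' B' X ⋄ prop A B X ⋄ prop A' B' X ⋄
              (f ⋄ X) ⋄ (g ⋄ X)) ⋄
            (Lemma.nullEq ⋄ A ⋄ B ⋄ A' ⋄ B' ⋄ X ⋄
              (g ⋄ null 1 A' B' X ⋄ (con .nullIsNull 1 1 ⋄ A' ⋄ B' ⋄ X)) ⋄
              (f ⋄ null 1 A B X ⋄ (con .nullIsNull 1 1 ⋄ A ⋄ B ⋄ X)))))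

/-- Nullness at an index `(A, hA)` of the presentation computes to nullness for `‖A‖`. Thus `nulGen`
gives one implication, and evaluation at `(T x, genOf)` the other. -/
def sheafificationEq : Exp × Exp :=
  (pi (U 1) fun I => pi (I ⇾ U 0) fun T =>
    eq 2 modalityData (sheafification I T)
      (sheafification (generatedIndex I T) (generated I T)),
   lam (U 1) fun I => lam (I ⇾ U 0) fun T =>
    let J := generatedIndex I T
    let B := lam I fun x => trunc 1 (T ⋄ x)
    let B' := lam J fun p => trunc 1 (generated I T ⋄ p)
    Lemma.nullificationEq ⋄ I ⋄ B ⋄ J ⋄ B' ⋄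
      (lam (U 1) fun X => lam (isNull 1 I B X) fun h =>
        uncurry 1 1 (U 0) (fun A => gen 0 1 I T A) (fun p => nul X (B' ⋄ p))
          fun A hA => Lemma.nulGen ⋄ I ⋄ T ⋄ X ⋄ h ⋄ A ⋄ hA) ⋄
      (lam (U 1) fun X => lam (isNull 1 J B' X) fun h => lam I fun x =>
        h ⋄ mk 1 (U 0) (fun A => gen 0 1 I T A) (T ⋄ x) (con (.genOf 0) 1 1 ⋄ I ⋄ T ⋄ x)))

/-- The lemmas, latest first: pairs of a statement and a proof, which may use the previous ones. -/
def development : List (Exp × Exp) :=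
  [nullificationEq, nullEq, nullInverse, nullExtend, nulGen, nulSum, nulUnit, nulLocal, nulMono,
    nulSeparated, nulValue, nulIntro, pairEq, underEq, underPath, propExt, univalencePath,
    propEquiv, propContr, propPi, propIsSet, equivFiber, equivInjective, isoIsEquiv, cancel]

end Ann
-- Running the checker, and the conclusion.
theorem checked_sheafificationEq :
    Pre.Checked 200 (Ann.sheafificationEq :: Ann.development) := by
  repeat' apply And.intro
  all_goals first | exact trivial | decide +kernel

/-- The interpretation of level codes: `0` stands for `i`, and `n + 1` for `m + n`. -/
def levels (i m : ℕ) : ℕ → ℕ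
  | 0 => i
  | n + 1 => m + n

theorem levels_strictMono {i m : ℕ} (him : i < m) : StrictMono (levels i m) := by
  refine strictMono_nat_of_lt_succ fun n => ?_
  cases n <;> simp [levels, him]

end HoTT

theorem mainTheorem12 (i m : ℕ) (him : i < m) :
    HoTT.Theorem
      (HoTT.pi (HoTT.U m) fun I => HoTT.pi (HoTT.arr I (HoTT.U i)) fun T =>
        HoTT.eq (HoTT.modalityData m)
          (HoTT.sheafification m I T)
          (HoTT.sheafification m (HoTT.generatedIndex i I T) (HoTT.generated i I T))) := by
  -- The codes `0`, `1`, `2` are read as `i`, `m`, `m + 1`; the last is the level of `U m` itself,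
  -- needed for the type of modality data.
  obtain ⟨_, t, ht⟩ := HoTT.Pre.Checked.exists_der (HoTT.levels_strictMono him)
    HoTT.checked_sheafificationEq
  -- The statement mentions no lemma variable, so substitution of the lemmas leaves it unchanged, by
  -- computation.
  exact ⟨t, ht.hasType .nil⟩
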